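/- All rings are commutative and Noetherian. Let $(R,\mathfrak m,k)$ be a Cohen-Macaulay local ring of Krull dimension $d$ with minimal multiplicity, i.e. $e(R)=\mu(\mathfrak m)-d+1$, where $\mu(\mathfrak m)$ is the minimal number of generators of $\mathfrak m$, and $e(R)$ is the multiplicity of $R$, i.e. $d!$ times the leading coefficient of the Hilbert-Samuel polynomial $P$ of $R$ (the polynomial of degree $d$ with $P(n)=\operatorname{length}_R(R/\mathfrak m^{n+1})$ for all $n\gg 0$). For $n\ge 0$ let $\Omega_n^R(k)$ denote the $n$th syzygy module of $k$, i.e. the image of the $n$th differential of an augmented minimal free resolution of $k$ (so $\Omega_0^R(k)=k$). Let $L$ be a non-zero maximal Cohen-Macaulay $R$-module (i.e. finitely generated with $\operatorname{depth} L=d$) that is a homomorphic image of a finite direct sum of modules of the form $\Omega_n^R(k)$, $n\ge 0$ (repetitions allowed). Then the following statements are equivalent: (i) $\operatorname{Ext}_R^i(L,R)=0$ for some $d+1$ consecutive values of $i\ge 1$, i.e. there is $s\ge 1$ with $\operatorname{Ext}_R^i(L,R)=0$ for all $s\le i\le s+d$; (ii) $\operatorname{Ext}_R^i(L,R)=0$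 for all $i\ge 1$; (iii) $R$ is Gorenstein, i.e. $R$ has finite injective dimension as an $R$-module. -/

import Mathlib

universe u

namespace LocalAlgebra

open IsLocalRing

section Depth

variable (R : Type u) [CommRing R] [IsLocalRing R]

/-- The depth of a module over a local ring: the supremum of the lengths of the regular sequences
on the module that consist of elements of the maximal ideal. -/
noncomputable def depth (M : Type u) [AddCommGroup M] [Module R M] : ℕ∞ :=
  ⨆ (rs : List R) (_ : RingTheory.Sequence.IsRegular M rs ∧ ∀ r ∈ rs, r ∈ maximalIdeal R),
    (rs.length : ℕ∞)

/-- A (Noetherian) local ring is Cohen-Macaulay if its depth equals its Krull dimension. -/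
def IsCohenMacaulay : Prop :=
  ((depth R R : ℕ∞) : WithBot ℕ∞) = ringKrullDim R

/-- A finitely generated module is maximal Cohen-Macaulay if its depth equals the Krull dimension
of the ring. (Used below only for non-zero modules.) -/
structure IsMaximalCohenMacaulay (M : Type u) [AddCommGroup M] [Module R M] : Prop where
  finite : Module.Finite R M
  depth_eq : ((depth R M : ℕ∞) : WithBot ℕ∞) = ringKrullDim R

/-- A (Noetherian) local ring is Gorenstein if it has finite injective dimension as a module over
itself. -/
def IsGorenstein : Prop :=
  ∃ n : ℕ, CategoryTheory.HasInjectiveDimensionLE (ModuleCat.of R R) n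

end Depth

section Multiplicity

variable (R : Type u) [CommRing R] [IsLocalRing R]

/-- `P` is the Hilbert-Samuel polynomial of `R`: `P n` is the length of `R ⧸ 𝔪 ^ (n + 1)` for all
large `n`. (These lengths are finite when `R` is Noetherian, and `P` is determined by them.) -/
def IsHilbertSamuelPolynomial (P : Polynomial ℚ) : Prop :=
  ∀ᶠ n : ℕ in Filter.atTop,
    ((Module.length R (R ⧸ maximalIdeal R ^ (n + 1))).toNat : ℚ) = P.eval (n : ℚ)

/-- `e` is the multiplicity of `R`: the normalized leading coefficient of its Hilbert-Samuel
polynomial `P`, that is, `P n = (e / δ!) * n ^ δ + (terms of lower degree)` where `δ` is the degree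
of `P` (which is the dimension of `R` when `R` is Noetherian). -/
def IsMultiplicity (e : ℕ) : Prop :=
  ∃ P : Polynomial ℚ, IsHilbertSamuelPolynomial R P ∧
    (e : ℚ) = (P.natDegree.factorial : ℚ) * P.leadingCoeff

/-- `R` has minimal multiplicity: `e(R) = μ(𝔪) - dim R + 1`. -/
def HasMinimalMultiplicity : Prop :=
  ∃ e d : ℕ, IsMultiplicity R e ∧ ringKrullDim R = d ∧
    (e : ℤ) = ((maximalIdeal R).spanFinrank : ℤ) - (d : ℤ) + 1

end Multiplicity

section Syzygy

/-- An (augmented) minimal free resolution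
`⋯ ⟶ R ^ rank 2 ⟶ R ^ rank 1 ⟶ R ^ rank 0 ⟶ M ⟶ 0` of a finitely generated module `M` over a
(Noetherian) local ring `R`. -/
structure MinimalFreeResolution (R : Type u) [CommRing R] [IsLocalRing R]
    (M : Type u) [AddCommGroup M] [Module R M] where
  rank : ℕ → ℕ
  aug : (Fin (rank 0) → R) →ₗ[R] M
  diff : ∀ n : ℕ, (Fin (rank (n + 1)) → R) →ₗ[R] (Fin (rank n) → R)
  aug_surjective : Function.Surjective aug
  exact_aug : Function.Exact (diff 0) aug
  exact_diff : ∀ n : ℕ, Function.Exact (diff (n + 1)) (diff n)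
  minimal : ∀ n : ℕ, LinearMap.range (diff n) ≤
    maximalIdeal R • (⊤ : Submodule R (Fin (rank n) → R))

/-- The `n`-th syzygy module of `M`: the image of the `n`-th differential of the augmented minimal
free resolution, the `0`-th differential being the augmentation. -/
noncomputable def MinimalFreeResolution.syzygy {R : Type u} [CommRing R] [IsLocalRing R]
    {M : Type u} [AddCommGroup M] [Module R M] (F : MinimalFreeResolution R M) :
    ℕ → ModuleCat.{u} R
  | 0 => ModuleCat.of R (LinearMap.range F.aug)
  | n + 1 => ModuleCat.of R (LinearMap.range (F.diff n))

end Syzygy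

section Existence

variable {R : Type u} [CommRing R] [IsLocalRing R]

/-- Every finitely generated module over a local ring has a minimal free cover. -/
theorem exists_minimal_cover (M : Type u) [AddCommGroup M] [Module R M] [Module.Finite R M] :
    ∃ (n : ℕ) (p : (Fin n → R) →ₗ[R] M), Function.Surjective p ∧
      LinearMap.ker p ≤ maximalIdeal R • (⊤ : Submodule R (Fin n → R)) := by
  classical
  have hex : ∃ (n : ℕ), ∃ (p : (Fin n → R) →ₗ[R] M), Function.Surjective p := by
    obtain ⟨n, p, hp⟩ := Module.Finite.exists_fin' R M
    exact ⟨n, p, hp⟩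
  obtain ⟨p, hp⟩ := Nat.find_spec hex
  have hmin : ∀ m < Nat.find hex, ¬ ∃ (p : (Fin m → R) →ₗ[R] M), Function.Surjective p :=
    fun m hm => Nat.find_min hex hm
  generalize Nat.find hex = n at p hp hmin
  refine ⟨n, p, hp, fun x hx => ?_⟩
  have hcoord : ∀ i, x i ∈ maximalIdeal R := by
    intro i
    by_contra hi
    have hu : IsUnit (x i) := by
      simpa [IsLocalRing.mem_maximalIdeal, mem_nonunits_iff] using hi
    obtain _ | k := n
    · exact i.elim0
    apply hmin k (Nat.lt_succ_self k)
    refine ⟨Fintype.linearCombination R (fun j => p (Pi.single (i.succAbove j) 1)), ?_⟩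
    rw [← LinearMap.range_eq_top, Fintype.range_linearCombination, eq_top_iff,
      ← LinearMap.range_eq_top.2 hp]
    rintro _ ⟨y, rfl⟩
    have hexp : ∀ z : Fin (k + 1) → R, p z = z i • p (Pi.single i 1)
        + ∑ j, z (i.succAbove j) • p (Pi.single (i.succAbove j) 1) := by
      intro z
      conv_lhs => rw [pi_eq_sum_univ' z]
      rw [map_sum, Fin.sum_univ_succAbove _ i]
      simp only [map_smul]
    have hs : ∀ z : Fin (k + 1) → R,
        ∑ j, z (i.succAbove j) • p (Pi.single (i.succAbove j) 1) ∈
          Submodule.span R (Set.range fun j => p (Pi.single (i.succAbove j) 1)) := fun z =>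
      Submodule.sum_mem _ fun j _ => Submodule.smul_mem _ _ (Submodule.subset_span ⟨j, rfl⟩)
    rw [hexp y]
    refine Submodule.add_mem _ (Submodule.smul_mem _ _ ?_) (hs y)
    have h0 := hexp x
    rw [LinearMap.mem_ker.1 hx] at h0
    rw [← Submodule.smul_mem_iff_of_isUnit _ hu, eq_neg_of_add_eq_zero_left h0.symm]
    exact Submodule.neg_mem _ (hs x)
  rw [pi_eq_sum_univ' x]
  exact Submodule.sum_mem _ fun i _ => Submodule.smul_mem_smul (hcoord i) trivial

/-- Every finitely generated module over a Noetherian local ring has a minimal free resolution. -/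
theorem nonempty_minimalFreeResolution [IsNoetherianRing R]
    (M : Type u) [AddCommGroup M] [Module R M] [Module.Finite R M] :
    Nonempty (MinimalFreeResolution R M) := by
  obtain ⟨n₀, aug, haug, hk⟩ := exists_minimal_cover (R := R) M
  have step : ∀ (a : ℕ) (K : Submodule R (Fin a → R)), ∃ (n : ℕ)
      (q : (Fin n → R) →ₗ[R] (Fin a → R)), LinearMap.range q = K ∧ LinearMap.ker q ≤ maximalIdeal R • ⊤ := by
    intro a K
    obtain ⟨n, q, hq, hqk⟩ := exists_minimal_cover (R := R) K
    refine ⟨n, K.subtype ∘ₗ q, ?_, ?_⟩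
    · rw [LinearMap.range_comp, LinearMap.range_eq_top.2 hq, Submodule.map_top,
        Submodule.range_subtype]
    · rw [LinearMap.ker_comp_of_ker_eq_bot _ K.ker_subtype]
      exact hqk
  choose len q hq hqk using step
  let st : ℕ → Σ a : ℕ, Submodule R (Fin a → R) := fun n =>
    Nat.rec ⟨n₀, LinearMap.ker aug⟩ (fun _ s => ⟨len s.1 s.2, LinearMap.ker (q s.1 s.2)⟩) n
  have hmin : ∀ n, (st n).2 ≤ maximalIdeal R • ⊤
    | 0 => hk
    | n + 1 => hqk _ _
  exact ⟨{
    rank := fun n => (st n).1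
    aug := aug
    diff := fun n => q (st n).1 (st n).2
    aug_surjective := haug
    exact_aug := LinearMap.exact_iff.2 (hq _ _).symm
    exact_diff := fun n => LinearMap.exact_iff.2 (hq _ _).symm
    minimal := fun n => (hq _ _).le.trans (hmin n) }⟩

end Existence

end LocalAlgebra

/-! (ii) ⇒ (i) is trivial. For (iii) ⇒ (ii), divide `L` by a maximal regular sequence. The quotient
has finite length, so over a Gorenstein ring its `Ext` into `R` vanishes above degree `d`, and
Nakayama lifts the vanishing to `L` (`IsGorenstein.extVanishes`).

The substance is (i) ⇒ (iii). A faithfully flat extension makes the residue field infinite. A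
general sequence `xs` of length `d`, regular on the ring and on `L`, then has `e(R) = length
R/(xs)`, and minimal multiplicity turns this into `𝔪² = (xs)𝔪` with `xs` part of a minimal
generating set of `𝔪` (`HasMinimalMultiplicity.exists_isRegular`).

Under these conditions every syzygy `Ω` of `k` satisfies `𝔪Ω ⊆ (xs)Ω`. The induction runs on a
stronger property, `IsRegularOnMaximalIdealSMul`, which holds for `k` because `𝔪k = 0` and which
passes from a module to its syzygy. The inclusion is inherited by sums and quotients, so `L/(xs)L`
is a nonzero `k`-vector space.

Dividing by `xs` contracts the `d + 1` consecutive vanishings to `Ext^{s+d}(L/(xs)L, R) = 0`, whence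
`Ext^{s+d}(k, R) = 0`. Now `𝔪/(xs)` is a `k`-vector space too, and `R/(xs)` has no `Ext` into `R`
above degree `d`, so `0 → 𝔪/(xs) → R/(xs) → k → 0` spreads the vanishing to every degree above `d`
(`ExtVanishes.residueField_of_maximalIdeal_smul_le`). Noetherian induction on cyclic modules and
Baer's criterion then bound the injective dimension of `R` by `d`. -/

namespace LocalAlgebra

open CategoryTheory Abelian IsLocalRing
open scoped Pointwise TensorProduct

/-! ### Vanishing of `Ext` into the ring: long exact sequences -/

section ExtVanishing

variable (R : Type u) [CommRing R]

/-- The vanishing of the module `Extⁱ(M, R)`. -/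
def ExtVanishes (M : Type u) [AddCommGroup M] [Module R M] (i : ℕ) : Prop :=
  Subsingleton (Ext (ModuleCat.of R M) (ModuleCat.of R R) i)

variable {R} {A B C : Type u} [AddCommGroup A] [Module R A] [AddCommGroup B] [Module R B]
  [AddCommGroup C] [Module R C]

theorem ExtVanishes.eq_zero {i : ℕ} (h : ExtVanishes R A i)
    (x : Ext (ModuleCat.of R A) (ModuleCat.of R R) i) : x = 0 :=
  Subsingleton.elim (h := h) _ _

theorem ExtVanishes.of_forall {i : ℕ}
    (h : ∀ x : Ext (ModuleCat.of R A) (ModuleCat.of R R) i, x = 0) : ExtVanishes R A i :=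
  ⟨fun x y => by rw [h x, h y]⟩

theorem ExtVanishes.of_retract {i : ℕ} (h : ExtVanishes R B i) (f : A →ₗ[R] B) (g : B →ₗ[R] A)
    (hfg : g ∘ₗ f = LinearMap.id) : ExtVanishes R A i := by
  refine .of_forall fun x => ?_
  have h1 : ModuleCat.ofHom f ≫ ModuleCat.ofHom g = 𝟙 (ModuleCat.of R A) := by
    rw [← ModuleCat.ofHom_comp, hfg]; rfl
  rw [← x.mk₀_id_comp, ← h1, ← Ext.mk₀_comp_mk₀_assoc,
    h.eq_zero ((Ext.mk₀ (ModuleCat.ofHom g)).comp x (zero_add i)), Ext.comp_zero]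

theorem ExtVanishes.of_linearEquiv {i : ℕ} (h : ExtVanishes R B i) (e : A ≃ₗ[R] B) :
    ExtVanishes R A i :=
  h.of_retract e.toLinearMap e.symm.toLinearMap (by ext; simp)

theorem extVanishes_of_subsingleton [Subsingleton A] (i : ℕ) : ExtVanishes R A i := by
  refine .of_forall fun x => ?_
  have h1 : 𝟙 (ModuleCat.of R A) = 0 := by ext a; exact Subsingleton.elim _ _
  rw [← x.mk₀_id_comp, h1, Ext.mk₀_zero, Ext.zero_comp]

theorem extVanishes_of_projective [Module.Projective R A] (i : ℕ) : ExtVanishes R A (i + 1) := by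
  have : Projective (ModuleCat.of R A) := inferInstance
  exact .of_forall fun x => x.eq_zero_of_projective

/-- The short exact sequence in `ModuleCat` attached to an exact sequence of linear maps. -/
theorem shortExact_of_exact {f : A →ₗ[R] B} {g : B →ₗ[R] C} (hf : Function.Injective f)
    (hfg : Function.Exact f g) (hg : Function.Surjective g) :
    (ModuleCat.shortComplexOfCompEqZero f g hfg.linearMap_comp_eq_zero).ShortExact :=
  ModuleCat.shortComplex_shortExact _ hfg hf hg

variable {f : A →ₗ[R] B} {g : B →ₗ[R] C} (hf : Function.Injective f)
    (hfg : Function.Exact f g) (hg : Function.Surjective g)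

include hf hfg hg

theorem ExtVanishes.middle {i : ℕ} (hA : ExtVanishes R A i) (hC : ExtVanishes R C i) :
    ExtVanishes R B i := by
  refine .of_forall fun x => ?_
  obtain ⟨y, rfl⟩ := Ext.contravariant_sequence_exact₂ (shortExact_of_exact hf hfg hg) _ x
    (hA.eq_zero _)
  rw [hC.eq_zero y, Ext.comp_zero]

theorem ExtVanishes.right {i : ℕ} (hA : ExtVanishes R A i) (hB : ExtVanishes R B (i + 1)) :
    ExtVanishes R C (i + 1) := by
  refine .of_forall fun x => ?_
  obtain ⟨y, rfl⟩ := Ext.contravariant_sequence_exact₃ (shortExact_of_exact hf hfg hg) _ x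
    (hB.eq_zero _) (add_comm 1 i)
  rw [hA.eq_zero y, Ext.comp_zero]

theorem ExtVanishes.left {i : ℕ} (hB : ExtVanishes R B i) (hC : ExtVanishes R C (i + 1)) :
    ExtVanishes R A i := by
  refine .of_forall fun x => ?_
  obtain ⟨y, rfl⟩ := Ext.contravariant_sequence_exact₁ (shortExact_of_exact hf hfg hg) _ x
    (add_comm 1 i) (hC.eq_zero _)
  rw [hB.eq_zero y, Ext.comp_zero]

theorem extVanishes_succ_iff [Module.Projective R B] (i : ℕ) :
    ExtVanishes R C (i + 2) ↔ ExtVanishes R A (i + 1) :=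
  ⟨fun h => .left hf hfg hg (extVanishes_of_projective _) h,
    fun h => .right hf hfg hg h (extVanishes_of_projective _)⟩

/-- `Ext¹(C, R)` vanishes if and only if linear forms extend from the first syzygy of `C`. -/
theorem extVanishes_one_iff [Module.Projective R B] :
    ExtVanishes R C 1 ↔ Function.Surjective (LinearMap.lcomp R R f) := by
  constructor
  · intro h φ
    obtain ⟨y, hy⟩ := Ext.contravariant_sequence_exact₁ (shortExact_of_exact hf hfg hg) _
      (Ext.mk₀ (ModuleCat.ofHom φ)) (add_comm 1 0) (h.eq_zero _)
    obtain ⟨ψ, rfl⟩ := Ext.homEquiv₀.symm.surjective y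
    refine ⟨ψ.hom, ?_⟩
    have := Ext.homEquiv₀.symm.injective (a₁ := ModuleCat.ofHom f ≫ ψ) (a₂ := ModuleCat.ofHom φ)
      (by simpa using hy)
    exact congrArg ModuleCat.Hom.hom this
  · intro h
    refine .of_forall fun x => ?_
    obtain ⟨y, rfl⟩ := Ext.contravariant_sequence_exact₃ (shortExact_of_exact hf hfg hg) _ x
      ((extVanishes_of_projective 0).eq_zero _) (add_comm 1 0)
    obtain ⟨φ, rfl⟩ := Ext.homEquiv₀.symm.surjective y
    obtain ⟨ψ, hψ⟩ := h φ.hom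
    have : φ = (ModuleCat.shortComplexOfCompEqZero f g hfg.linearMap_comp_eq_zero).f ≫
        ModuleCat.ofHom ψ := by
      ext1
      exact hψ.symm
    rw [this, Ext.homEquiv₀_symm_apply, ← Ext.mk₀_comp_mk₀]
    exact ShortComplex.ShortExact.extClass_comp_assoc _ _

end ExtVanishing

section Local

variable {R : Type u} [CommRing R]

theorem exact_lsmul_mkQ (M : Type u) [AddCommGroup M] [Module R M] (x : R) :
    Function.Exact (LinearMap.lsmul R M x) (x • (⊤ : Submodule R M)).mkQ :=
  LinearMap.exact_lsmul_mkQ_smul_top M x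

variable {M : Type u} [AddCommGroup M] [Module R M]

theorem ExtVanishes.quotSMulTop {x : R} (hx : IsSMulRegular M x) {i : ℕ}
    (h₁ : ExtVanishes R M i) (h₂ : ExtVanishes R M (i + 1)) :
    ExtVanishes R (QuotSMulTop x M) (i + 1) :=
  .right (f := LinearMap.lsmul R M x) hx (exact_lsmul_mkQ M x) (Submodule.mkQ_surjective _) h₁ h₂

/-- If `x` is a regular element on `M` in the maximal ideal, then `Extⁱ(M, R)` vanishes when
`Extⁱ⁺¹(M ⧸ xM, R)` does. -/
theorem ExtVanishes.of_quotSMulTop [IsLocalRing R] [IsNoetherianRing R] [Module.Finite R M]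
    {x : R} (hx : IsSMulRegular M x) (hm : x ∈ maximalIdeal R) {i : ℕ}
    (h : ExtVanishes R (QuotSMulTop x M) (i + 1)) : ExtVanishes R M i := by
  by_contra hn
  have : Nontrivial (Ext (ModuleCat.of R M) (ModuleCat.of R R) i) :=
    not_subsingleton_iff_nontrivial.1 hn
  -- Nakayama: by the long exact sequence the finite module `Extⁱ(M, R)` equals `x` times itself.
  refine Submodule.top_ne_pointwise_smul_of_mem_jacobson_annihilator
    (M := Ext (ModuleCat.of R M) (ModuleCat.of R R) i) (r := x)
    (maximalIdeal_le_jacobson _ hm) (eq_comm.1 (eq_top_iff.2 fun y _ => ?_))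
  obtain ⟨z, hz⟩ := Ext.contravariant_sequence_exact₁ (shortExact_of_exact
    (f := LinearMap.lsmul R M x) hx (exact_lsmul_mkQ M x) (Submodule.mkQ_surjective _)) _ y
    (add_comm 1 i) (h.eq_zero _)
  have hz' : x • z = y := by
    rw [← hz]
    have : (ModuleCat.shortComplexOfCompEqZero (LinearMap.lsmul R M x)
      (x • (⊤ : Submodule R M)).mkQ (exact_lsmul_mkQ M x).linearMap_comp_eq_zero).f =
        x • 𝟙 (ModuleCat.of R M) := rfl
    rw [this, Ext.mk₀_smul, Ext.smul_comp, Ext.mk₀_id_comp]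
  exact Submodule.mem_smul_pointwise_iff_exists _ _ _ |>.2 ⟨z, trivial, hz'⟩

end Local


/-! ### Faithfully flat descent of `Ext` vanishing -/

section BaseChange

variable {R S : Type u} [CommRing R] [CommRing S] [Algebra R S] [Module.FaithfullyFlat R S]

/-- `Hom` out of a finitely presented module commutes with flat base change, so the restriction map
over `S` is the base change of the one over `R`, and faithful flatness reflects surjectivity.
Through `extVanishes_one_iff` this is the `Ext¹` case of descent. -/
theorem surjective_lcomp_baseChange_iff {K F : Type u} [AddCommGroup K] [Module R K]
    [AddCommGroup F] [Module R F] [Module.FinitePresentation R K] [Module.FinitePresentation R F]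
    (f : K →ₗ[R] F) :
    Function.Surjective (LinearMap.lcomp S S (f.baseChange S)) ↔
      Function.Surjective (LinearMap.lcomp R R f) := by
  have hF := Module.FinitePresentation.isBaseChange_map R F R S
  have hK := Module.FinitePresentation.isBaseChange_map R K R S
  have hcomm : LinearMap.lcomp S (S ⊗[R] R) (f.baseChange S) ∘ₗ hF.equiv.toLinearMap =
      hK.equiv.toLinearMap ∘ₗ (LinearMap.lcomp R R f).baseChange S := by
    refine TensorProduct.AlgebraTensorModule.curry_injective (LinearMap.ext fun s ↦
      LinearMap.ext fun φ ↦ TensorProduct.AlgebraTensorModule.curry_injective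
        (LinearMap.ext fun s ↦ LinearMap.ext fun m ↦ ?_))
    simp [IsBaseChange.equiv_tmul]
  have h1 : Function.Surjective (LinearMap.lcomp S (S ⊗[R] R) (f.baseChange S)) ↔
      Function.Surjective ((LinearMap.lcomp R R f).baseChange S) := by
    rw [← EquivLike.surjective_comp hF.equiv, ← EquivLike.comp_surjective _ hK.equiv]
    exact iff_of_eq (congrArg Function.Surjective (congrArg DFunLike.coe hcomm))
  have h2 : Function.Surjective ((LinearMap.lcomp R R f).baseChange S) ↔
      Function.Surjective (LinearMap.lcomp R R f) :=
    Module.FaithfullyFlat.lTensor_surjective_iff_surjective R S _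
  -- In `h1` the forms take values in `S ⊗[R] R`; `e` moves them to `S`.
  let e := TensorProduct.AlgebraTensorModule.rid R S S
  rw [← h2, ← h1]
  constructor
  · intro h φ
    obtain ⟨ψ, hψ⟩ := h (e.toLinearMap ∘ₗ φ)
    refine ⟨e.symm.toLinearMap ∘ₗ ψ, ?_⟩
    change (e.symm.toLinearMap ∘ₗ ψ) ∘ₗ _ = _
    change ψ ∘ₗ _ = _ at hψ
    rw [LinearMap.comp_assoc, hψ]
    ext; simp
  · intro h φ
    obtain ⟨ψ, hψ⟩ := h (e.symm.toLinearMap ∘ₗ φ)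
    refine ⟨e.toLinearMap ∘ₗ ψ, ?_⟩
    change (e.toLinearMap ∘ₗ ψ) ∘ₗ _ = _
    change ψ ∘ₗ _ = _ at hψ
    rw [LinearMap.comp_assoc, hψ]
    ext; simp

/-- Dimension shifting along a free cover, which stays a free cover over `S`, reduces everything to
`Ext¹`; the `Ext` modules themselves are never compared. -/
theorem extVanishes_baseChange_iff [IsNoetherianRing R] (M : Type u) [AddCommGroup M] [Module R M]
    [Module.Finite R M] (i : ℕ) :
    ExtVanishes S (S ⊗[R] M) (i + 1) ↔ ExtVanishes R M (i + 1) := by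
  induction i generalizing M with
  | zero =>
    obtain ⟨n, p, hp⟩ := Module.Finite.exists_fin' R M
    have hex := p.exact_subtype_ker_map
    have : Module.FinitePresentation R (LinearMap.ker p) := Module.finitePresentation_of_finite R _
    rw [extVanishes_one_iff (LinearMap.ker p).injective_subtype hex hp, extVanishes_one_iff
      (f := (LinearMap.ker p).subtype.baseChange S) (g := p.baseChange S)
      (Module.Flat.lTensor_preserves_injective_linearMap _ (LinearMap.ker p).injective_subtype)
      (lTensor_exact S hex hp) (LinearMap.lTensor_surjective S hp),
      surjective_lcomp_baseChange_iff]
  | succ i ih =>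
    obtain ⟨n, p, hp⟩ := Module.Finite.exists_fin' R M
    have hex := p.exact_subtype_ker_map
    rw [extVanishes_succ_iff (LinearMap.ker p).injective_subtype hex hp, extVanishes_succ_iff
      (f := (LinearMap.ker p).subtype.baseChange S) (g := p.baseChange S)
      (Module.Flat.lTensor_preserves_injective_linearMap _ (LinearMap.ker p).injective_subtype)
      (lTensor_exact S hex hp) (LinearMap.lTensor_surjective S hp), ih]

end BaseChange

/-! ### Syzygies and the property `IsRegularOnMaximalIdealSMul` -/

theorem ofList_take_succ {A : Type u} [CommRing A] (xs : List A) {j : ℕ} (hj : j < xs.length) :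
    Ideal.ofList (xs.take (j + 1)) = Ideal.ofList (xs.take j) ⊔ Ideal.span {xs[j]} := by
  rw [List.take_add_one, List.getElem?_eq_getElem hj, Ideal.ofList_append]
  simp

section Syzygies

variable {A : Type u} [CommRing A] [IsLocalRing A]

/-- The elements of `xs` behave on `𝔪M`, relative to `M`, like a regular sequence. -/
def IsRegularOnMaximalIdealSMul (xs : List A) (M : Type u) [AddCommGroup M] [Module A M] : Prop :=
  ∀ (j : ℕ) (hj : j < xs.length), ∀ w ∈ maximalIdeal A • (⊤ : Submodule A M),
    xs[j] • w ∈ Ideal.ofList (xs.take j) • (⊤ : Submodule A M) →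
      w ∈ Ideal.ofList (xs.take j) • (⊤ : Submodule A M)

theorem isRegularOnMaximalIdealSMul_of_smul_eq_bot (xs : List A) (M : Type u) [AddCommGroup M]
    [Module A M] (h : maximalIdeal A • (⊤ : Submodule A M) = ⊥) :
    IsRegularOnMaximalIdealSMul xs M := by
  intro j hj w hw _
  rw [h, Submodule.mem_bot] at hw
  rw [hw]
  exact zero_mem _

variable {xs : List A} {K F M : Type u} [AddCommGroup K] [Module A K] [AddCommGroup F]
  [Module A F] [AddCommGroup M] [Module A M] {ι : K →ₗ[A] F} {p : F →ₗ[A] M}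

/-- Write `ι w = v + x_j u` with `u ∈ 𝔪F` and `v` in the part coming from the earlier elements. In
`M` this says that `x_j p(u)` lies in `(x_i : i < j)M`, so `p(u)` does too by `hM`. Lifting `p(u)`
to `τ ∈ (x_i : i < j)F` gives `u - τ = ι w'`, and `w - x_j w'` falls under the induction hypothesis.
-/
theorem mem_smul_top_of_injective_exact (hι : Function.Injective ι) (hιp : Function.Exact ι p)
    (hp : Function.Surjective p) (hxs : ∀ x ∈ xs, x ∈ maximalIdeal A)
    (hM : IsRegularOnMaximalIdealSMul xs M) (j : ℕ) (hj : j ≤ xs.length) (w : K)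
    (hw : ι w ∈ Ideal.ofList (xs.take j) • maximalIdeal A • (⊤ : Submodule A F)) :
    w ∈ Ideal.ofList (xs.take j) • (⊤ : Submodule A K) := by
  induction j generalizing w with
  | zero =>
    simp only [List.take_zero, Ideal.ofList_nil, Submodule.bot_smul, Submodule.mem_bot] at hw ⊢
    exact hι (by rw [hw, map_zero])
  | succ j ih =>
    have hj' : j < xs.length := hj
    have hxj : xs[j] ∈ maximalIdeal A := hxs _ (List.getElem_mem _)
    have hmap : ∀ I : Ideal A, (I • (⊤ : Submodule A F)).map p = I • (⊤ : Submodule A M) := by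
      intro I
      rw [Submodule.map_smul'', Submodule.map_top, LinearMap.range_eq_top.2 hp]
    rw [ofList_take_succ xs hj', Submodule.sup_smul, Submodule.mem_sup] at hw ⊢
    obtain ⟨v, hv, y, hy, hvy⟩ := hw
    rw [Submodule.ideal_span_singleton_smul, Submodule.mem_smul_pointwise_iff_exists] at hy
    obtain ⟨u, hu, rfl⟩ := hy
    have hpu : p u ∈ maximalIdeal A • (⊤ : Submodule A M) := by
      rw [← hmap]
      exact Submodule.mem_map_of_mem hu
    have hpv : p v ∈ Ideal.ofList (xs.take j) • (⊤ : Submodule A M) := by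
      rw [← hmap]
      exact Submodule.mem_map_of_mem (Submodule.smul_mono le_rfl le_top hv)
    have h0 : p v + xs[j] • p u = 0 := by
      rw [← map_smul, ← map_add, hvy]
      exact hιp.apply_apply_eq_zero w
    have hpu' := hM j hj' (p u) hpu (by
      rw [eq_neg_of_add_eq_zero_right h0]
      exact neg_mem hpv)
    rw [← hmap] at hpu'
    obtain ⟨τ, hτ, hτu⟩ := hpu'
    obtain ⟨w', hw'⟩ := (hιp (u - τ)).1 (by rw [map_sub, hτu, sub_self])
    refine ⟨w - xs[j] • w', ih hj'.le _ ?_, xs[j] • w', ?_, by abel⟩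
    · have : ι (w - xs[j] • w') = v + xs[j] • τ := by
        rw [map_sub, map_smul, hw', ← hvy]
        module
      rw [this]
      refine add_mem hv ?_
      rw [← mul_smul, mul_comm, mul_smul]
      exact Submodule.smul_mem_smul hxj hτ
    · exact Submodule.smul_mem_smul (Ideal.mem_span_singleton_self _) trivial

theorem map_mem_sq_smul_top (hmin : LinearMap.range ι ≤ maximalIdeal A • (⊤ : Submodule A F))
    {w : K} (hw : w ∈ maximalIdeal A • (⊤ : Submodule A K)) :
    ι w ∈ maximalIdeal A ^ 2 • (⊤ : Submodule A F) := by
  rw [sq, mul_smul]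
  have h1 : ι w ∈ (maximalIdeal A • (⊤ : Submodule A K)).map ι := Submodule.mem_map_of_mem hw
  rw [Submodule.map_smul'', Submodule.map_top] at h1
  exact Submodule.smul_mono le_rfl hmin h1

/-- If `w ∈ 𝔪K` and `x_j w ∈ (x_i : i < j)K`, then regularity on `F` puts `ι w` in `(x_i : i < j)F`,
and minimality puts it in `𝔪²F`. By `hind` it lies in `(x_i : i < j)𝔪F`, and
`mem_smul_top_of_injective_exact` pulls this back to `K`. -/
theorem IsRegularOnMaximalIdealSMul.syzygy (hι : Function.Injective ι)
    (hιp : Function.Exact ι p) (hp : Function.Surjective p)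
    (hmin : LinearMap.range ι ≤ maximalIdeal A • (⊤ : Submodule A F))
    (hxs : ∀ x ∈ xs, x ∈ maximalIdeal A) (hreg : RingTheory.Sequence.IsWeaklyRegular F xs)
    (hind : ∀ j < xs.length, (Ideal.ofList (xs.take j) • (⊤ : Submodule A F)) ⊓
      (maximalIdeal A ^ 2 • ⊤) ≤ Ideal.ofList (xs.take j) • maximalIdeal A • ⊤)
    (hM : IsRegularOnMaximalIdealSMul xs M) : IsRegularOnMaximalIdealSMul xs K := by
  intro j hj w hw hxw
  refine mem_smul_top_of_injective_exact hι hιp hp hxs hM j hj.le w (hind j hj ⟨?_, ?_⟩)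
  · have h1 : ι (xs[j] • w) ∈ (Ideal.ofList (xs.take j) • (⊤ : Submodule A K)).map ι :=
      Submodule.mem_map_of_mem hxw
    rw [Submodule.map_smul'', map_smul] at h1
    have h2 := Submodule.smul_mono (le_refl (Ideal.ofList (xs.take j))) le_top h1
    have h3 := hreg.regular_mod_prev j hj
    exact (isSMulRegular_quotient_iff_mem_of_smul_mem _ _).1 h3 _ h2
  · exact map_mem_sq_smul_top hmin hw

/-- Minimality gives `ι(𝔪K) ⊆ 𝔪²F ⊆ (xs)𝔪F`, which the same lemma pulls back to `(xs)K`. -/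
theorem IsRegularOnMaximalIdealSMul.maximalIdeal_smul_le (hι : Function.Injective ι)
    (hιp : Function.Exact ι p) (hp : Function.Surjective p)
    (hmin : LinearMap.range ι ≤ maximalIdeal A • (⊤ : Submodule A F))
    (hxs : ∀ x ∈ xs, x ∈ maximalIdeal A)
    (hsq : maximalIdeal A ^ 2 ≤ Ideal.ofList xs * maximalIdeal A)
    (hM : IsRegularOnMaximalIdealSMul xs M) :
    maximalIdeal A • (⊤ : Submodule A K) ≤ Ideal.ofList xs • ⊤ := by
  intro w hw
  have := mem_smul_top_of_injective_exact hι hιp hp hxs hM xs.length le_rfl w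
  rw [List.take_length] at this
  refine this ?_
  rw [← mul_smul]
  exact Submodule.smul_mono_left hsq (map_mem_sq_smul_top hmin hw)

end Syzygies

section Independence

variable {A : Type u} [CommRing A] [IsLocalRing A]

/-- If `y + r x_j ∈ 𝔪²` with `y` in the ideal of the earlier elements, then `r ∈ 𝔪`, since a unit
`r` would contradict `hxs`. Hence `r x_j ∈ 𝔪²`, and induction applies to `y`. -/
theorem ofList_take_inf_sq_le {xs : List A} (hm : ∀ x ∈ xs, x ∈ maximalIdeal A)
    (hxs : ∀ (j : ℕ) (hj : j < xs.length),
      xs[j] ∉ Ideal.ofList (xs.take j) ⊔ maximalIdeal A ^ 2) (j : ℕ) (hj : j ≤ xs.length) :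
    Ideal.ofList (xs.take j) ⊓ maximalIdeal A ^ 2 ≤ Ideal.ofList (xs.take j) * maximalIdeal A := by
  induction j with
  | zero => simp
  | succ j ih =>
    have hj' : j < xs.length := hj
    rintro a ⟨ha, ha2⟩
    rw [SetLike.mem_coe, ofList_take_succ xs hj', Submodule.mem_sup] at ha
    obtain ⟨y, hy, z, hz, rfl⟩ := ha
    obtain ⟨r, rfl⟩ := Ideal.mem_span_singleton'.1 hz
    have hr : r ∈ maximalIdeal A := by
      by_contra hr
      have hu : IsUnit r := by simpa using hr
      refine hxs j hj' ((Ideal.unit_mul_mem_iff_mem _ hu).1 ?_)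
      have : r * xs[j] = -y + (y + r * xs[j]) := by ring
      rw [this]
      exact Submodule.add_mem_sup (neg_mem hy) ha2
    have hrx : r * xs[j] ∈ maximalIdeal A ^ 2 := by
      rw [sq]
      exact Ideal.mul_mem_mul hr (hm _ (List.getElem_mem _))
    rw [ofList_take_succ xs hj', Ideal.sup_mul]
    refine Submodule.add_mem_sup (ih hj'.le ⟨hy, ?_⟩) ?_
    · have : y = (y + r * xs[j]) - r * xs[j] := by ring
      rw [this]
      exact sub_mem ha2 hrx
    · rw [mul_comm r]
      exact Ideal.mul_mem_mul (Ideal.mem_span_singleton_self _) hr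

theorem mem_ideal_smul_top_iff_repr {R F ι : Type*} [CommRing R] [AddCommGroup F] [Module R F]
    (b : Module.Basis ι R F) (I : Ideal R) (x : F) :
    x ∈ I • (⊤ : Submodule R F) ↔ ∀ i, b.repr x i ∈ I := by
  constructor
  · intro hx i
    have h : b.coord i x ∈ (I • (⊤ : Submodule R F)).map (b.coord i) :=
      Submodule.mem_map_of_mem hx
    rw [Submodule.map_smul''] at h
    simpa using Submodule.smul_mono (le_refl I) le_top h
  · intro h
    rw [← b.linearCombination_repr x, Finsupp.linearCombination_apply, Finsupp.sum]
    exact Submodule.sum_mem _ fun i _ => Submodule.smul_mem_smul (h i) trivial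

theorem smul_top_inf_smul_top_le {R F : Type*} [CommRing R] [AddCommGroup F] [Module R F]
    [Module.Free R F] {I J K : Ideal R} (h : I ⊓ J ≤ K) :
    (I • (⊤ : Submodule R F)) ⊓ (J • ⊤) ≤ K • ⊤ := by
  let b := Module.Free.chooseBasis R F
  rintro x ⟨hI, hJ⟩
  rw [SetLike.mem_coe, mem_ideal_smul_top_iff_repr b] at hI hJ
  rw [mem_ideal_smul_top_iff_repr b]
  exact fun i => h ⟨hI i, hJ i⟩

end Independence

/-! ### Finite length, regular sequences and the residue field -/

section FiniteLength

variable {R : Type u} [CommRing R] [IsLocalRing R] [IsNoetherianRing R]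
  {M : Type u} [AddCommGroup M] [Module R M] [Module.Finite R M]

/-- The only possible prime of `R ⧸ Ann M` is the image of `𝔪`, so this Noetherian ring is Artinian
and `M` is a finite module over it. -/
theorem isFiniteLength_of_pow_le_annihilator {n : ℕ}
    (h : maximalIdeal R ^ n ≤ Module.annihilator R M) : IsFiniteLength R M := by
  have hdim : Ring.KrullDimLE 0 (R ⧸ Module.annihilator R M) := by
    rw [Ring.krullDimLE_zero_iff]
    intro P hP
    have hsurj := Ideal.Quotient.mk_surjective (I := Module.annihilator R M)
    have hPm : P.comap (Ideal.Quotient.mk (Module.annihilator R M)) = maximalIdeal R := by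
      refine le_antisymm (le_maximalIdeal (Ideal.IsPrime.comap _).ne_top) ?_
      refine (Ideal.IsPrime.comap _ : (P.comap _).IsPrime).le_of_pow_le
        (n := n) (h.trans fun x hx => ?_)
      rw [Ideal.mem_comap, Ideal.Quotient.eq_zero_iff_mem.2 hx]
      exact zero_mem _
    have : (P.comap (Ideal.Quotient.mk (Module.annihilator R M))).IsMaximal :=
      hPm ▸ inferInstance
    rw [← Ideal.map_comap_of_surjective _ hsurj P]
    refine (Ideal.map_eq_top_or_isMaximal_of_surjective _ hsurj this).resolve_left ?_
    rw [Ideal.map_comap_of_surjective _ hsurj P]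
    exact hP.ne_top
  have hart : IsArtinianRing (R ⧸ Module.annihilator R M) :=
    IsNoetherianRing.isArtinianRing_of_krullDimLE_zero
  let _ : Module (R ⧸ Module.annihilator R M) M :=
    Module.quotientAnnihilator
  have : Module.Finite (R ⧸ Module.annihilator R M) M :=
    Module.Finite.of_restrictScalars_finite R _ _
  have h1 : IsArtinian (R ⧸ Module.annihilator R M) M := inferInstance
  rw [isFiniteLength_iff_isNoetherian_isArtinian]
  let e : M →ₛₗ[Ideal.Quotient.mk (Module.annihilator R M)] M := ⟨.id _, fun _ _ => rfl⟩
  have : RingHomSurjective (Ideal.Quotient.mk (Module.annihilator R M)) :=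
    ⟨Ideal.Quotient.mk_surjective⟩
  exact ⟨inferInstance, (e.isArtinian_iff_of_bijective Function.bijective_id).2 h1⟩

theorem exists_pow_le_annihilator_of_supportDim_le_zero (h : Module.supportDim R M ≤ 0) :
    ∃ n : ℕ, maximalIdeal R ^ n ≤ Module.annihilator R M := by
  rcases subsingleton_or_nontrivial M with hM | hM
  · exact ⟨0, by rw [Module.annihilator_eq_top_iff.2 hM]; exact le_top⟩
  · have h0 : Module.supportDim R M = 0 := by
      refine le_antisymm h ?_
      have := Module.supportDim_ne_bot_of_nontrivial R M
      rw [WithBot.ne_bot_iff_exists] at this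
      obtain ⟨a, ha⟩ := this
      rw [← ha]
      exact_mod_cast bot_le (a := a)
    have h1 := support_of_supportDim_eq_zero R M h0
    rw [Module.support_eq_zeroLocus, PrimeSpectrum.zeroLocus_eq_iff] at h1
    refine Ideal.exists_pow_le_of_le_radical_of_fg ?_ (IsNoetherian.noetherian _)
    rw [h1]
    exact Ideal.le_radical

theorem isFiniteLength_of_supportDim_le_zero (h : Module.supportDim R M ≤ 0) :
    IsFiniteLength R M := by
  obtain ⟨n, hn⟩ := exists_pow_le_annihilator_of_supportDim_le_zero h
  exact isFiniteLength_of_pow_le_annihilator hn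

theorem isFiniteLength_quotient_of_isRegular {xs : List R}
    (hxs : RingTheory.Sequence.IsRegular M xs) (hdim : ringKrullDim R ≤ xs.length) :
    IsFiniteLength R (M ⧸ (Ideal.ofList xs • ⊤ : Submodule R M)) := by
  apply isFiniteLength_of_supportDim_le_zero
  have h := Module.supportDim_add_length_eq_supportDim_of_isRegular xs hxs
  have h2 := (h.le.trans (Module.supportDim_le_ringKrullDim R M)).trans hdim
  have h3 : Module.supportDim R (M ⧸ (Ideal.ofList xs • ⊤ : Submodule R M)) + (xs.length : ℕ) ≤
    0 + (xs.length : ℕ) := by simpa using h2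
  exact ENat.WithBot.add_le_add_natCast_right_iff.1 h3

end FiniteLength

section RegularSequences

variable {R : Type u} [CommRing R] {M : Type u} [AddCommGroup M] [Module R M]

/-- Each regular element turns two adjacent vanishings into one, in the higher degree. A window of
`xs.length + 1` degrees thus shrinks to its top degree. -/
theorem ExtVanishes.quotient_ofList {xs : List R}
    (hxs : RingTheory.Sequence.IsWeaklyRegular M xs) (s : ℕ)
    (h : ∀ i, s ≤ i → i ≤ s + xs.length → ExtVanishes R M i) :
    ExtVanishes R (M ⧸ (Ideal.ofList xs • ⊤ : Submodule R M)) (s + xs.length) := by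
  induction xs generalizing M s with
  | nil =>
    refine (h s le_rfl le_rfl).of_linearEquiv ?_
    exact Submodule.quotEquivOfEqBot _ (by simp)
  | cons x xs ih =>
    rw [RingTheory.Sequence.isWeaklyRegular_cons_iff] at hxs
    have := ih hxs.2 (s + 1) fun i hi hi' => by
      obtain ⟨i, rfl⟩ : ∃ k, i = k + 1 := ⟨i - 1, by omega⟩
      exact .quotSMulTop hxs.1 (h _ (by omega) (by simp; omega))
        (h _ (by omega) (by simp; omega))
    have h2 := this.of_linearEquiv (Submodule.quotOfListConsSMulTopEquivQuotSMulTopInner M x xs)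
    rwa [List.length_cons, add_comm xs.length, ← add_assoc]

theorem ExtVanishes.of_quotient_ofList [IsLocalRing R] [IsNoetherianRing R] [Module.Finite R M]
    {xs : List R} (hxs : RingTheory.Sequence.IsWeaklyRegular M xs)
    (hm : ∀ x ∈ xs, x ∈ maximalIdeal R) (i : ℕ)
    (h : ExtVanishes R (M ⧸ (Ideal.ofList xs • ⊤ : Submodule R M)) (i + xs.length)) :
    ExtVanishes R M i := by
  induction xs generalizing M i with
  | nil => exact h.of_linearEquiv (Submodule.quotEquivOfEqBot _ (by simp)).symm
  | cons x xs ih =>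
    rw [RingTheory.Sequence.isWeaklyRegular_cons_iff] at hxs
    simp only [List.mem_cons, forall_eq_or_imp] at hm
    refine .of_quotSMulTop hxs.1 hm.1 (ih hxs.2 hm.2 (i + 1) ?_)
    have h2 := h.of_linearEquiv
      (Submodule.quotOfListConsSMulTopEquivQuotSMulTopInner M x xs).symm
    rwa [List.length_cons, add_comm xs.length, ← add_assoc] at h2

end RegularSequences

section ResidueField

variable {R : Type u} [CommRing R] [IsLocalRing R] {M : Type u} [AddCommGroup M] [Module R M]

theorem nonempty_linearEquiv_residueField [IsSimpleModule R M] :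
    Nonempty (M ≃ₗ[R] ResidueField R) := by
  obtain ⟨m, hm, ⟨e⟩⟩ := isSimpleModule_iff_quot_maximal.mp ‹IsSimpleModule R M›
  rw [eq_maximalIdeal hm] at e
  exact ⟨e⟩

theorem ExtVanishes.of_isFiniteLength {i : ℕ} (hk : ExtVanishes R (ResidueField R) i)
    (h : IsFiniteLength R M) : ExtVanishes R M i := by
  induction h with
  | of_subsingleton => exact extVanishes_of_subsingleton i
  | @of_simple_quotient M _ _ N _ _ ih =>
    obtain ⟨e⟩ := nonempty_linearEquiv_residueField (R := R) (M := M ⧸ N)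
    exact .middle N.injective_subtype (LinearMap.exact_subtype_mkQ N) N.mkQ_surjective ih
      (hk.of_linearEquiv e)

/-- The residue field is a direct summand of every nonzero module killed by the maximal ideal. -/
theorem exists_residueField_retract [Nontrivial M]
    (h : maximalIdeal R • (⊤ : Submodule R M) = ⊥) :
    ∃ (f : ResidueField R →ₗ[R] M) (g : M →ₗ[R] ResidueField R), g ∘ₗ f = LinearMap.id := by
  have ht : Module.IsTorsionBySet R M (maximalIdeal R) := fun x a => by
    have : (a : R) • x ∈ maximalIdeal R • (⊤ : Submodule R M) :=
      Submodule.smul_mem_smul a.2 trivial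
    rwa [h, Submodule.mem_bot] at this
  -- `M` is a vector space, so a nonzero vector and a functional not killing it split off a line.
  let _ : Module (ResidueField R) M := ht.module
  have : IsScalarTower R (ResidueField R) M := ht.isScalarTower
  obtain ⟨v, hv⟩ := exists_ne (0 : M)
  obtain ⟨φ, hφ⟩ := Module.Projective.exists_dual_ne_zero (ResidueField R) hv
  refine ⟨(LinearMap.toSpanSingleton (ResidueField R) M ((φ v)⁻¹ • v)).restrictScalars R,
    φ.restrictScalars R, ?_⟩
  ext a
  simp [hφ]

theorem exists_residueField_injective [Nontrivial M] (h : IsFiniteLength R M) :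
    ∃ f : ResidueField R →ₗ[R] M, Function.Injective f := by
  rw [isFiniteLength_iff_isNoetherian_isArtinian] at h
  have := h.2
  obtain ⟨N, hN⟩ := IsAtomic.exists_atom (Submodule R M)
  rw [← isSimpleModule_iff_isAtom] at hN
  obtain ⟨e⟩ := nonempty_linearEquiv_residueField (R := R) (M := N)
  exact ⟨N.subtype ∘ₗ e.symm.toLinearMap, N.injective_subtype.comp e.symm.injective⟩

end ResidueField

/-! ### Injective dimension and the Gorenstein property -/

section InjectiveDimension

variable {R : Type u} [CommRing R]

theorem injective_of_subsingleton_ext_quotient (N : ModuleCat.{u} R)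
    (h : ∀ I : Ideal R, Subsingleton (Ext (ModuleCat.of R (R ⧸ I)) N 1)) : Injective N := by
  have : Module.Injective R N := by
    rw [← Module.Baer.iff_injective]
    intro I g
    have hS := shortExact_of_exact (A := I) (B := R) (C := R ⧸ I) I.injective_subtype
      (LinearMap.exact_subtype_mkQ I) (Submodule.mkQ_surjective I)
    obtain ⟨y, hy⟩ := Ext.contravariant_sequence_exact₁ hS N (Ext.mk₀ (ModuleCat.ofHom g))
      (add_comm 1 0) ((h I).elim _ _)
    obtain ⟨ψ, rfl⟩ := Ext.homEquiv₀.symm.surjective y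
    have h1 := Ext.homEquiv₀.symm.injective
      (a₁ := ModuleCat.ofHom (Submodule.subtype I) ≫ ψ) (a₂ := ModuleCat.ofHom g)
      (by simpa using hy)
    refine ⟨ψ.hom, fun x hx => ?_⟩
    exact LinearMap.congr_fun (congrArg ModuleCat.Hom.hom h1) ⟨x, hx⟩
  exact (Module.injective_iff_injective_object R N).1 this

/-- Baer's criterion for the injective dimension. -/
theorem hasInjectiveDimensionLE_of_subsingleton_ext_quotient (d : ℕ) (N : ModuleCat.{u} R)
    (h : ∀ I : Ideal R, Subsingleton (Ext (ModuleCat.of R (R ⧸ I)) N (d + 1))) :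
    HasInjectiveDimensionLE N d := by
  induction d generalizing N with
  | zero =>
    have := injective_of_subsingleton_ext_quotient N h
    exact injective_iff_hasInjectiveDimensionLT_one.1 this
  | succ d ih =>
    -- Shift the degree along `0 → N → E → E/N → 0` with `E` injective.
    obtain ⟨E, _, f, _⟩ := EnoughInjectives.presentation N
    let T := ShortComplex.mk f (Limits.cokernel.π f) (Limits.cokernel.condition f)
    have hT : T.ShortExact := { exact := ShortComplex.exact_cokernel f }
    refine (hT.hasInjectiveDimensionLT_X₃_iff d ‹_›).1 (ih _ fun I => ⟨fun x y => ?_⟩)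
    have key : ∀ x : Ext (ModuleCat.of R (R ⧸ I)) T.X₃ (d + 1), x = 0 := by
      intro x
      obtain ⟨z, rfl⟩ := Ext.covariant_sequence_exact₃ _ hT x rfl ((h I).elim _ _)
      have hE : Injective T.X₂ := ‹_›
      rw [z.eq_zero_of_injective, Ext.zero_comp]
    exact (key x).trans (key y).symm

end InjectiveDimension

section Gorenstein

variable {R : Type u} [CommRing R] [IsLocalRing R] [IsNoetherianRing R]

/-- Noetherian induction on `I`, for `M ≅ R/I`. If `I` is prime but not maximal, some `x ∈ 𝔪 \ I` is
regular on `M`; `M/xM` is cyclic with a larger annihilator, and Nakayama descends from degree `i +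
1`. If `I` is proper and not prime, take `ab ∈ I` with `a, b ∉ I`: the submodule generated by the
image of `a` and its quotient are cyclic, with annihilators also containing `b` and `a`
respectively. The model `M` of `R/I` is left arbitrary so that these modules can be used directly.
-/
theorem ExtVanishes.of_cyclic {d : ℕ} (hk : ∀ i, d < i → ExtVanishes R (ResidueField R) i)
    (I : Ideal R) (M : Type u) [AddCommGroup M] [Module R M] (f : R →ₗ[R] M)
    (hf : Function.Surjective f) (hI : LinearMap.ker f = I) (i : ℕ) (hi : d < i) :
    ExtVanishes R M i := by
  induction I using WellFoundedGT.induction generalizing M i with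
  | ind I ih =>
  subst hI
  have hmem : ∀ r : R, r ∈ LinearMap.ker f ↔ r • f 1 = 0 := fun r => by
    rw [LinearMap.mem_ker, ← map_smul, smul_eq_mul, mul_one]
  have hfin : Module.Finite R M := Module.Finite.of_surjective f hf
  have hlt : ∀ {M' : Type u} [AddCommGroup M'] [Module R M'] (g : R →ₗ[R] M'),
      LinearMap.ker f ≤ LinearMap.ker g → ∀ a, g a = 0 → f a ≠ 0 →
        LinearMap.ker f < LinearMap.ker g :=
    fun g hle a ha hfa => lt_of_le_of_ne hle fun he => hfa (by
      rw [← LinearMap.mem_ker, he]; exact ha)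
  by_cases hprime : Ideal.IsPrime (LinearMap.ker f)
  · by_cases hmax : LinearMap.ker f = maximalIdeal R
    · refine (hk i hi).of_linearEquiv ?_
      exact (f.quotKerEquivOfSurjective hf).symm.trans (Submodule.quotEquivOfEq _ _ hmax)
    · obtain ⟨x, hxm, hx⟩ : ∃ x ∈ maximalIdeal R, x ∉ LinearMap.ker f := by
        by_contra! hcon
        exact hmax (le_antisymm (le_maximalIdeal hprime.ne_top) hcon)
      have hreg : IsSMulRegular M x := by
        rw [isSMulRegular_iff_right_eq_zero_of_smul]
        intro m hm
        obtain ⟨r, rfl⟩ := hf m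
        rw [← map_smul, smul_eq_mul] at hm
        exact (hprime.mem_or_mem hm).resolve_left hx
      refine .of_quotSMulTop hreg hxm ?_
      let g : R →ₗ[R] QuotSMulTop x M := (x • (⊤ : Submodule R M)).mkQ ∘ₗ f
      refine ih _ (hlt g (LinearMap.ker_le_ker_comp _ _) x ?_ hx) _ g
        ((Submodule.mkQ_surjective _).comp hf) rfl _ (by omega)
      have : f x = x • f 1 := by rw [← map_smul, smul_eq_mul, mul_one]
      simp only [g, LinearMap.comp_apply, this, Submodule.mkQ_apply,
        Submodule.Quotient.mk_eq_zero]
      exact Submodule.smul_mem_pointwise_smul _ _ _ trivial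
  · by_cases htop : LinearMap.ker f = ⊤
    · have : Subsingleton M := by
        rw [LinearMap.ker_eq_top] at htop
        refine ⟨fun a b => ?_⟩
        obtain ⟨a, rfl⟩ := hf a
        obtain ⟨b, rfl⟩ := hf b
        simp [htop]
      exact extVanishes_of_subsingleton i
    · rw [Ideal.isPrime_iff] at hprime
      push Not at hprime
      obtain ⟨a, b, hab, ha, hb⟩ := hprime htop
      let N : Submodule R M := Submodule.span R {f a}
      let g₁ : R →ₗ[R] N := LinearMap.toSpanSingleton R N ⟨f a, Submodule.mem_span_singleton_self _⟩
      let g₂ : R →ₗ[R] M ⧸ N := N.mkQ ∘ₗ f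
      have hg₁ : ∀ r, ((g₁ r : N) : M) = f (r * a) := fun r => by
        simp [g₁, ← smul_eq_mul]
      refine .middle N.injective_subtype (LinearMap.exact_subtype_mkQ N) N.mkQ_surjective
        (ih _ (hlt g₁ ?_ b ?_ hb) N g₁ ?_ rfl i hi)
        (ih _ (hlt g₂ (LinearMap.ker_le_ker_comp _ _) a ?_ ha) _ g₂
          (N.mkQ_surjective.comp hf) rfl i hi)
      · intro r hr
        rw [LinearMap.mem_ker, Subtype.ext_iff, hg₁, mul_comm, ← smul_eq_mul, map_smul,
          LinearMap.mem_ker.1 hr, smul_zero]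
        rfl
      · rw [Subtype.ext_iff, hg₁, mul_comm]
        exact hab
      · rintro ⟨m, hm⟩
        obtain ⟨r, rfl⟩ := Submodule.mem_span_singleton.1 hm
        refine ⟨r, Subtype.ext ?_⟩
        rw [hg₁, ← smul_eq_mul, map_smul]
      · simp only [g₂, LinearMap.comp_apply, Submodule.mkQ_apply, Submodule.Quotient.mk_eq_zero]
        exact Submodule.mem_span_singleton_self _

theorem isGorenstein_of_extVanishes {d : ℕ}
    (hk : ∀ i, d < i → ExtVanishes R (ResidueField R) i) : IsGorenstein R :=
  ⟨d, hasInjectiveDimensionLE_of_subsingleton_ext_quotient d _ fun I =>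
    ExtVanishes.of_cyclic hk I (R ⧸ I) (Submodule.mkQ I) (Submodule.mkQ_surjective I)
      (Submodule.ker_mkQ I) _ (Nat.lt_succ_self d)⟩

/-- A Gorenstein local ring of depth `dim R` satisfies `Extⁱ(k, R) = 0` for `i > dim R`. -/
theorem IsGorenstein.extVanishes_residueField (hG : IsGorenstein R) {xs : List R}
    (hxs : RingTheory.Sequence.IsRegular R xs) (hdim : ringKrullDim R ≤ xs.length) (i : ℕ)
    (hi : xs.length < i) : ExtVanishes R (ResidueField R) i := by
  obtain ⟨n, hn⟩ := hG
  by_contra hcon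
  let P : ℕ → Prop := fun j => ¬ ExtVanishes R (ResidueField R) j
  have hbound : ∀ j, P j → j ≤ n := fun j hj => by
    by_contra! hlt
    exact hj (HasInjectiveDimensionLT.subsingleton (ModuleCat.of R R) (n + 1) j hlt _)
  classical
  -- `m` is the top degree with `Ext^m(k, R) ≠ 0`, and `m ≥ i > xs.length`. Embed `k` in the
  -- finite-length module `R/(xs)`. The cokernel has no `Ext` in degree `m + 1`, so `Ext^m(R/(xs),
  -- R)` maps onto `Ext^m(k, R)`; but the source vanishes above degree `xs.length`.
  let m := Nat.findGreatest P n
  have hm : P m := Nat.findGreatest_spec (hbound i hcon) hcon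
  have him : i ≤ m := Nat.le_findGreatest (hbound i hcon) hcon
  have hm1 : ExtVanishes R (ResidueField R) (m + 1) := by
    by_contra h
    have := Nat.le_findGreatest (P := P) (hbound (m + 1) h) h
    omega
  have hlen := isFiniteLength_quotient_of_isRegular hxs hdim
  have := hxs.quot_ofList_smul_nontrivial ⊤
  obtain ⟨f, hf⟩ := exists_residueField_injective hlen
  have hext := ExtVanishes.quotient_ofList hxs.toIsWeaklyRegular (m - xs.length)
    (fun j hj _ => by
      obtain ⟨j, rfl⟩ : ∃ k, j = k + 1 := ⟨j - 1, by omega⟩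
      exact extVanishes_of_projective j)
  rw [Nat.sub_add_cancel (by omega)] at hext
  refine hm (.left hf (LinearMap.exact_map_mkQ_range f) (Submodule.mkQ_surjective _) hext
    (hm1.of_isFiniteLength (hlen.of_surjective (Submodule.mkQ_surjective _))))

theorem IsGorenstein.extVanishes (hG : IsGorenstein R) {xs : List R}
    (hxs : RingTheory.Sequence.IsRegular R xs) (hdim : ringKrullDim R ≤ xs.length)
    {L : Type u} [AddCommGroup L] [Module R L] [Module.Finite R L] {ys : List R}
    (hys : RingTheory.Sequence.IsRegular L ys) (hm : ∀ y ∈ ys, y ∈ maximalIdeal R)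
    (hlen : ys.length = xs.length) (i : ℕ) (hi : 1 ≤ i) : ExtVanishes R L i := by
  refine .of_quotient_ofList hys.toIsWeaklyRegular hm i ?_
  exact (hG.extVanishes_residueField hxs hdim _ (by omega)).of_isFiniteLength
    (isFiniteLength_quotient_of_isRegular hys (by rwa [hlen]))

end Gorenstein

section Depth

variable {R : Type u} [CommRing R] [IsLocalRing R] {M : Type u} [AddCommGroup M] [Module R M]

theorem exists_isRegular_of_depth_eq [Nontrivial M] {d : ℕ} (h : depth R M = d) :
    ∃ xs : List R, xs.length = d ∧ (∀ x ∈ xs, x ∈ maximalIdeal R) ∧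
      RingTheory.Sequence.IsRegular M xs := by
  obtain _ | d := d
  · exact ⟨[], rfl, by simp, .nil R M⟩
  · have hlt : (d : ℕ∞) < depth R M := by rw [h]; exact_mod_cast Nat.lt_succ_self d
    unfold depth at hlt
    simp only [lt_iSup_iff] at hlt
    obtain ⟨xs, hxs, hd⟩ := hlt
    have hle : (xs.length : ℕ∞) ≤ ((d + 1 : ℕ) : ℕ∞) := by
      rw [← h]
      exact le_iSup₂ (f := fun (rs : List R) (_ : RingTheory.Sequence.IsRegular M rs ∧
        ∀ r ∈ rs, r ∈ maximalIdeal R) => (rs.length : ℕ∞)) xs hxs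
    refine ⟨xs, ?_, hxs.2, hxs.1⟩
    have h1 : d < xs.length := by exact_mod_cast hd
    have h2 : xs.length ≤ d + 1 := by exact_mod_cast hle
    omega

end Depth

/-! ### General elements and superficial elements -/

section Avoidance

variable {A : Type u} [CommRing A] [IsLocalRing A] [Infinite (ResidueField A)]

/-- A finite module over a local ring with infinite residue field is not a finite union of proper
submodules. -/
theorem exists_forall_notMem_of_ne_top {M ι : Type*} [AddCommGroup M] [Module A M]
    [Module.Finite A M] (s : Finset ι) (p : ι → Submodule A M) (h : ∀ i ∈ s, p i ≠ ⊤) :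
    ∃ x, ∀ i ∈ s, x ∉ p i := by
  by_contra! hx
  -- B. H. Neumann's lemma: some member of a finite cover has finite index. A simple quotient above
  -- it is a finite copy of the residue field.
  obtain ⟨i, hi, hfin⟩ := Submodule.exists_finiteIndex_of_cover (p := p) (s := s)
    (Set.eq_univ_of_forall fun x => by
      obtain ⟨i, hi, hm⟩ := hx x
      exact Set.mem_biUnion hi hm)
  have : Finite (M ⧸ p i) := AddSubgroup.finite_quotient_of_finiteIndex
  obtain ⟨q, hq, hpq⟩ := (eq_top_or_exists_le_coatom (p i)).resolve_left (h i hi)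
  have : Finite (M ⧸ q) := Finite.of_surjective _ (Submodule.factor_surjective hpq)
  have : IsSimpleModule A (M ⧸ q) := isSimpleModule_iff_isCoatom.mpr hq
  obtain ⟨m, hm, ⟨e⟩⟩ := isSimpleModule_iff_quot_maximal.mp this
  rw [eq_maximalIdeal hm] at e
  have : Finite (ResidueField A) := Finite.of_equiv _ e.toEquiv
  exact not_finite (ResidueField A)

end Avoidance

section Torsion

/-- The minimal primes over the annihilator of `ker X ⊆ G` are associated primes of `G` containing
`X`. So `J` lies in the radical of that annihilator, and a power of `J` lies in the annihilator. -/
theorem exists_pow_smul_eq_zero_of_associatedPrimes {B : Type*} {G : Type*} [CommRing B]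
    [IsNoetherianRing B] [AddCommGroup G] [Module B G] [Module.Finite B G] (J : Ideal B) (X : B)
    (h : ∀ P ∈ associatedPrimes B G, X ∈ P → J ≤ P) :
    ∃ c : ℕ, ∀ g : G, X • g = 0 → ∀ b ∈ J ^ c, b • g = 0 := by
  let K := Submodule.torsionBy B G X
  have hJ : J ≤ (Module.annihilator B K).radical := by
    rw [← Ideal.sInf_minimalPrimes]
    refine le_sInf fun P hP => h P ?_ (hP.1.2 ?_)
    · exact associatedPrimes.subset_of_injective K.injective_subtype
        (Module.associatedPrimes.minimalPrimes_annihilator_subset_associatedPrimes B K hP)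
    · exact Module.mem_annihilator.mpr fun g => Subtype.ext g.2
  obtain ⟨c, hc⟩ := Ideal.exists_pow_le_of_le_radical_of_fg hJ (IsNoetherian.noetherian J)
  exact ⟨c, fun g hg b hb => congrArg Subtype.val (Module.mem_annihilator.mp (hc hb) ⟨g, hg⟩)⟩

end Torsion

section Superficial

variable {A : Type u} [CommRing A] (I : Ideal A)

/-- The degree one part of the Rees algebra. -/
noncomputable def reesMonomial : I →ₗ[A] reesAlgebra I :=
  ((Polynomial.monomial 1).comp I.subtype).codRestrict (Subalgebra.toSubmodule (reesAlgebra I))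
    fun a => reesAlgebra.monomial_mem.mpr (by simp)

theorem coe_reesMonomial (a : I) :
    (reesMonomial I a : Polynomial A) = Polynomial.monomial 1 (a : A) := rfl

theorem exists_monomial_mem_span_reesMonomial_pow (c : ℕ) (r : A) (hr : r ∈ I ^ c) :
    ∃ b ∈ Ideal.span (Set.range (reesMonomial I)) ^ c,
      (b : Polynomial A) = Polynomial.monomial c r := by
  induction c generalizing r with
  | zero => exact ⟨algebraMap A _ r, by simp, rfl⟩
  | succ c ih =>
    rw [pow_succ] at hr
    refine Submodule.mul_induction_on hr (fun a ha b hb => ?_) ?_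
    · obtain ⟨a', ha', e⟩ := ih a ha
      refine ⟨a' * reesMonomial I ⟨b, hb⟩, ?_, ?_⟩
      · rw [pow_succ]
        exact Ideal.mul_mem_mul ha' (Ideal.subset_span ⟨_, rfl⟩)
      · rw [MulMemClass.coe_mul, e, coe_reesMonomial, Polynomial.monomial_mul_monomial]
    · rintro x y ⟨a, ha, ea⟩ ⟨b, hb, eb⟩
      exact ⟨a + b, add_mem ha hb, by rw [AddMemClass.coe_add, ea, eb, map_add]⟩

variable [IsNoetherianRing A] (N : Type u) [AddCommGroup N] [Module A N] [Module.Finite A N]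

/-- Let `x` avoid the degree-one traces of the associated primes of the associated graded module
that do not contain all degree-one elements. Then a fixed power `J^c` of the ideal they generate
kills everything annihilated by the initial form of `x`. The filtration `Λ` below turns this into
vanishing of that annihilator in high degree. -/
theorem exists_superficial_of_associatedPrimes :
    ∃ s : Finset (Submodule A I), (∀ p ∈ s, p ≠ ⊤) ∧ ∀ x : I, (∀ p ∈ s, x ∉ p) →
      ∃ m : ℕ, ∀ n ≥ m, ∀ y ∈ (I ^ n • ⊤ : Submodule A N),
        (x : A) • y ∈ (I ^ (n + 2) • ⊤ : Submodule A N) →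
        y ∈ (I ^ (n + 1) • ⊤ : Submodule A N) := by
  classical
  let B := reesAlgebra I
  let E := (I.stableFiltration (⊤ : Submodule A N)).submodule
  let Φ : I.Filtration N :=
    { N := fun n => I ^ (n + 1) • ⊤
      mono := fun n => Submodule.smul_mono_left (Ideal.pow_le_pow_right (by omega))
      smul_le := fun n => by rw [← mul_smul, ← pow_succ'] }
  let E' := Φ.submodule
  -- The associated graded module `⨁ IⁿN / Iⁿ⁺¹N`, finite over the Rees algebra.
  let G := E.map E'.mkQ
  have : Module.Finite B G := Module.Finite.iff_fg.mpr
    (((Ideal.Filtration.submodule_fg_iff_stable _ fun i => IsNoetherian.noetherian _).mpr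
      (Ideal.stableFiltration_stable I ⊤)).map _)
  have hfin : (associatedPrimes B G).Finite := associatedPrimes.finite B G
  let J : Ideal B := Ideal.span (Set.range (reesMonomial I))
  -- `φ P` is all of `I` exactly when `J ≤ P`; such primes impose no condition on `x`, hence the
  -- `erase ⊤` below.
  let φ : Ideal B → Submodule A I := fun P => (P.restrictScalars A).comap (reesMonomial I)
  refine ⟨(hfin.toFinset.image φ).erase ⊤, fun p hp => (Finset.mem_erase.mp hp).1, fun x hx => ?_⟩
  obtain ⟨c, hc⟩ := exists_pow_smul_eq_zero_of_associatedPrimes (G := G) J (reesMonomial I x) (by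
    intro P hP hxP
    by_contra hJ
    refine hx (φ P) (Finset.mem_erase.mpr ⟨fun htop => hJ ?_, ?_⟩) hxP
    · refine Ideal.span_le.mpr ?_
      rintro _ ⟨a, rfl⟩
      have : a ∈ φ P := htop ▸ Submodule.mem_top
      exact this
    · exact Finset.mem_image_of_mem _ (hfin.mem_toFinset.mpr hP))
  have key (n : ℕ) (y : N) (hy : y ∈ (I ^ n • ⊤ : Submodule A N))
      (hxy : (x : A) • y ∈ (I ^ (n + 2) • ⊤ : Submodule A N)) (r : A) (hr : r ∈ I ^ c) :
      r • y ∈ (I ^ (n + c + 1) • ⊤ : Submodule A N) := by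
    have hsingle (k : ℕ) (F : I.Filtration N) (z : N) (hz : z ∈ F.N k) :
        PolynomialModule.single A k z ∈ F.submodule := fun i => by
      rw [PolynomialModule.coeff_single, Finsupp.single_apply]
      split_ifs with h
      · exact h ▸ hz
      · exact zero_mem _
    let g : G := ⟨E'.mkQ (PolynomialModule.single A n y),
      Submodule.mem_map_of_mem (hsingle n _ y hy)⟩
    have h0 : reesMonomial I x • g = 0 := by
      refine Subtype.ext ((Submodule.Quotient.mk_eq_zero E').mpr ?_)
      change (reesMonomial I x : Polynomial A) • PolynomialModule.single A n y ∈ E'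
      rw [coe_reesMonomial, PolynomialModule.monomial_smul_single]
      refine hsingle _ Φ _ ?_
      change _ ∈ I ^ (1 + n + 1) • ⊤
      rwa [show 1 + n + 1 = n + 2 by ring]
    obtain ⟨b, hb, e⟩ := exists_monomial_mem_span_reesMonomial_pow I c r hr
    have h1 := (Submodule.Quotient.mk_eq_zero E').mp (congrArg Subtype.val (hc g h0 b hb))
    change (b : Polynomial A) • PolynomialModule.single A n y ∈ E' at h1
    rw [e, PolynomialModule.monomial_smul_single] at h1
    have h2 := h1 (c + n)
    rw [PolynomialModule.coeff_single, Finsupp.single_eq_same] at h2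
    change _ ∈ I ^ (c + n + 1) • ⊤ at h2
    rwa [add_comm c n] at h2
  -- `Λ` collects the elements whose order is raised by at least two under `x`. Being contained in a
  -- stable filtration it is itself stable, so `Λ_{n₀+c+k} = I^k I^c Λ_{n₀}`, and `key` applies to
  -- `I^c Λ_{n₀}`.
  let Λ : I.Filtration N :=
    { N := fun n => I ^ n • ⊤ ⊓ (I ^ (n + 2) • ⊤ : Submodule A N).comap (LinearMap.lsmul A N x)
      mono := fun n => inf_le_inf (Submodule.smul_mono_left (Ideal.pow_le_pow_right (by omega)))
        (Submodule.comap_mono (Submodule.smul_mono_left (Ideal.pow_le_pow_right (by omega))))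
      smul_le := fun n => by
        refine Submodule.smul_le.mpr fun a ha y hy => ⟨?_, ?_⟩
        · rw [pow_succ', mul_smul]
          exact Submodule.smul_mem_smul ha hy.1
        · change (x : A) • a • y ∈ (I ^ (n + 1 + 2) • ⊤ : Submodule A N)
          rw [smul_comm, show n + 1 + 2 = n + 2 + 1 by ring, pow_succ' I (n + 2), mul_smul]
          exact Submodule.smul_mem_smul ha hy.2 }
  obtain ⟨n₀, hn₀⟩ := ((I.stableFiltration_stable (⊤ : Submodule A N)).of_le
    (F' := Λ) (fun n => inf_le_left)).exists_pow_smul_eq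
  refine ⟨n₀ + c, fun n hn y hy hxy => ?_⟩
  obtain ⟨k, rfl⟩ := Nat.exists_eq_add_of_le hn
  have hmem : y ∈ Λ.N (n₀ + (k + c)) := by
    rw [show n₀ + (k + c) = n₀ + c + k by ring]
    exact ⟨hy, hxy⟩
  rw [hn₀, pow_add, mul_smul] at hmem
  have hle : I ^ c • Λ.N n₀ ≤ (I ^ (n₀ + c + 1) • ⊤ : Submodule A N) :=
    Submodule.smul_le.mpr fun r hr z hz => key n₀ z hz.1 hz.2 r hr
  have := Submodule.smul_mono le_rfl hle hmem
  rwa [← mul_smul, ← pow_add, show k + (n₀ + c + 1) = n₀ + c + k + 1 by ring] at this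

/-- If multiplication by `x` is injective on `N`, then `x • y ∈ I ^ (n + 1) N` implies
`y ∈ I ^ (n - k) N` for a fixed `k`. -/
theorem exists_mem_of_smul_mem (x : A) (hx : IsSMulRegular N x) :
    ∃ k : ℕ, ∀ n, ∀ y : N, x • y ∈ (I ^ (n + k) • ⊤ : Submodule A N) →
      y ∈ (I ^ n • ⊤ : Submodule A N) := by
  -- Artin–Rees for `xN ⊆ N`.
  obtain ⟨k, hk⟩ := Ideal.exists_pow_inf_eq_pow_smul I (LinearMap.range (LinearMap.lsmul A N x))
  refine ⟨k, fun n y hy => ?_⟩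
  have h1 : x • y ∈ I ^ (n + k) • ⊤ ⊓ LinearMap.range (LinearMap.lsmul A N x) := ⟨hy, y, rfl⟩
  rw [hk _ (by omega), Nat.add_sub_cancel] at h1
  have h2 := Submodule.smul_mono le_rfl inf_le_right h1
  rw [LinearMap.range_eq_map, ← Submodule.map_smul''] at h2
  obtain ⟨z, hz, e⟩ := h2
  rwa [← hx e]

/-- Elements of `I` outside finitely many proper submodules of `I` are superficial for `N`. -/
theorem exists_superficial :
    ∃ s : Finset (Submodule A I), (∀ p ∈ s, p ≠ ⊤) ∧ ∀ x : I, (∀ p ∈ s, x ∉ p) →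
      IsSMulRegular N (x : A) → ∃ m : ℕ, ∀ n ≥ m, ∀ y : N,
        (x : A) • y ∈ (I ^ (n + 1) • ⊤ : Submodule A N) → y ∈ (I ^ n • ⊤ : Submodule A N) := by
  obtain ⟨s, hs, h⟩ := exists_superficial_of_associatedPrimes I N
  refine ⟨s, hs, fun x hx hreg => ?_⟩
  obtain ⟨m, hm⟩ := h x hx
  obtain ⟨k, hk⟩ := exists_mem_of_smul_mem I N x hreg
  refine ⟨m + k, fun n hn y hy => ?_⟩
  -- Artin–Rees places `y` in order `m`; from there `hm` raises the order one step at a time up to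
  -- `n`.
  have claim (j : ℕ) (hj : m + j ≤ n) : y ∈ (I ^ (m + j) • ⊤ : Submodule A N) := by
    induction j with
    | zero =>
      refine hk m y (Submodule.smul_mono_left (Ideal.pow_le_pow_right (by omega)) hy)
    | succ j ih =>
      exact hm (m + j) (by omega) y (ih (by omega))
        (Submodule.smul_mono_left (Ideal.pow_le_pow_right (by omega)) hy)
  obtain ⟨j, rfl⟩ := Nat.exists_eq_add_of_le (show m ≤ n by omega)
  exact claim j le_rfl

end Superficial

section DepthDrop

variable {A : Type u} [CommRing A] [IsLocalRing A] [IsNoetherianRing A]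
  {N : Type u} [AddCommGroup N] [Module A N] [Module.Finite A N]

/-- A general `x` need not belong to the given sequence `ys`. Depth is therefore read off from the
vanishing of `Ext(k, -)` in low degrees, of which multiplication by `x` costs one. -/
theorem exists_isRegular_quotSMulTop {d : ℕ} {ys : List A}
    (hys : RingTheory.Sequence.IsRegular N ys) (hm : ∀ y ∈ ys, y ∈ maximalIdeal A)
    (hlen : ys.length = d + 1) {x : A} (hx : x ∈ maximalIdeal A) (hreg : IsSMulRegular N x) :
    ∃ zs : List A, zs.length = d ∧ (∀ z ∈ zs, z ∈ maximalIdeal A) ∧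
      RingTheory.Sequence.IsRegular (QuotSMulTop x N) zs := by
  have hN : Nontrivial N := hys.nontrivial
  have hsupp : Module.support A (ModuleCat.of A (A ⧸ maximalIdeal A)) =
      PrimeSpectrum.zeroLocus (maximalIdeal A) := by
    rw [Module.support_eq_zeroLocus, Ideal.annihilator_quotient]
  have hlt (M : Type u) [AddCommGroup M] [Module A M] [Module.Finite A M] [Nontrivial M] :
      maximalIdeal A • (⊤ : Submodule A M) < ⊤ :=
    lt_top_iff_ne_top.mpr
      (Submodule.top_ne_ideal_smul_of_le_jacobson_annihilator (maximalIdeal_le_jacobson _)).symm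
  have hext := ModuleCat.subsingleton_ext_of_exists_isRegular (maximalIdeal A)
    (ModuleCat.of A (A ⧸ maximalIdeal A)) hsupp.le (ModuleCat.of A N) (hlt N) ys hm hys
  have hQ : Nontrivial (QuotSMulTop x N) := by
    rw [Submodule.Quotient.nontrivial_iff]
    refine ((Submodule.ideal_span_singleton_smul x ⊤).symm.trans_lt
      (lt_of_le_of_lt (Submodule.smul_mono_left ?_) (hlt N))).ne
    exact (Ideal.span_singleton_le_iff_mem _).mpr hx
  refine ModuleCat.exists_isRegular_of_exists_subsingleton_ext (maximalIdeal A) d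
    (ModuleCat.of A (QuotSMulTop x N)) (hlt _) (ModuleCat.of A (A ⧸ maximalIdeal A)) hsupp ?_
  intro i hi
  have hS := shortExact_of_exact (f := LinearMap.lsmul A N x) (g := (x • (⊤ : Submodule A N)).mkQ)
    hreg (exact_lsmul_mkQ N x) (Submodule.mkQ_surjective _)
  have h0 (z : Ext (ModuleCat.of A (A ⧸ maximalIdeal A)) (ModuleCat.of A (QuotSMulTop x N)) i) :
      z = 0 := by
    obtain ⟨w, rfl⟩ := Ext.covariant_sequence_exact₃ _ hS z rfl
      ((hext (i + 1) (by omega)).elim _ _)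
    rw [(hext i (by omega)).elim w 0, Ext.zero_comp]
  exact ⟨fun a b => (h0 a).trans (h0 b).symm⟩

end DepthDrop

/-! ### Hilbert polynomials and multiplicity -/

section HilbertFunction

open Polynomial in
-- By Taylor expansion the `n`th coefficient of `P(X - 1)` is the value at `-1` of the `n`th Hasse
-- derivative of `P`, here of degree at most one. Consequently the normalized coefficient `d! ·
-- coeff d` survives the passage to differences.
theorem coeff_sub_comp_X_sub_one (P : ℚ[X]) {n : ℕ} (h : P.natDegree ≤ n + 1) :
    (P - P.comp (X - C 1)).coeff n = (n + 1) * P.coeff (n + 1) := by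
  have h1 : P.comp (X - C 1) = taylor (-1) P := by simp [taylor_apply, sub_eq_add_neg]
  have h2 : (hasseDeriv n P).natDegree < 2 :=
    lt_of_le_of_lt (natDegree_hasseDeriv_le P n) (by omega)
  rw [coeff_sub, h1, taylor_coeff, eval_eq_sum_range' h2]
  simp [Finset.sum_range_succ, hasseDeriv_coeff, add_comm 1 n]

open Polynomial in
theorem natDegree_le_succ_of_sub_comp (P : ℚ[X]) {d : ℕ}
    (h : (P - P.comp (X - C 1)).natDegree ≤ d) : P.natDegree ≤ d + 1 := by
  by_contra! hlt
  obtain ⟨n, hn⟩ : ∃ n, P.natDegree = n + 1 := ⟨P.natDegree - 1, by omega⟩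
  have h1 := coeff_sub_comp_X_sub_one P hn.le
  rw [coeff_eq_zero_of_natDegree_lt (by omega)] at h1
  have h2 : P.coeff (n + 1) ≠ 0 := by
    rw [← hn]
    exact leadingCoeff_ne_zero.mpr fun h0 => by simp [h0] at hn
  exact mul_ne_zero (by positivity) h2 h1.symm

variable {A : Type u} [CommRing A] (I : Ideal A)
  (N : Type u) [AddCommGroup N] [Module A N]

/-- Lengths add along `0 → N/IⁿN → N/Iⁿ⁺¹N → (N/xN)/Iⁿ⁺¹(N/xN) → 0`, the first map being
multiplication by `x`; `h` is its injectivity. -/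
theorem length_quotient_pow_succ_eq_add (x : A) (hx : x ∈ I) (n : ℕ)
    (h : ∀ y : N, x • y ∈ (I ^ (n + 1) • ⊤ : Submodule A N) → y ∈ (I ^ n • ⊤ : Submodule A N)) :
    Module.length A (N ⧸ (I ^ (n + 1) • ⊤ : Submodule A N)) =
      Module.length A (N ⧸ (I ^ n • ⊤ : Submodule A N)) +
      Module.length A (QuotSMulTop x N ⧸ (I ^ (n + 1) • ⊤ : Submodule A (QuotSMulTop x N))) := by
  have hle : (I ^ n • ⊤ : Submodule A N) ≤
      (I ^ (n + 1) • ⊤ : Submodule A N).comap (LinearMap.lsmul A N x) :=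
    fun y hy => by
      change x • y ∈ (I ^ (n + 1) • ⊤ : Submodule A N)
      rw [pow_succ', mul_smul]
      exact Submodule.smul_mem_smul hx hy
  have hmap : (I ^ (n + 1) • ⊤ : Submodule A (QuotSMulTop x N)) =
      (I ^ (n + 1) • ⊤ : Submodule A N).map (x • (⊤ : Submodule A N)).mkQ := by
    rw [Submodule.map_smul'', Submodule.map_top, Submodule.range_mkQ]
  have hle' : (I ^ (n + 1) • ⊤ : Submodule A N) ≤
      (I ^ (n + 1) • ⊤ : Submodule A (QuotSMulTop x N)).comap (x • (⊤ : Submodule A N)).mkQ := by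
    rw [hmap]
    exact Submodule.le_comap_map _ _
  refine Module.length_eq_add_of_exact (Submodule.mapQ _ _ _ hle) (Submodule.mapQ _ _ _ hle')
    ?_ ?_ ?_
  · rw [← LinearMap.ker_eq_bot, eq_bot_iff]
    intro z hz
    obtain ⟨y, rfl⟩ := Submodule.mkQ_surjective _ z
    rw [LinearMap.mem_ker, Submodule.mkQ_apply, Submodule.mapQ_apply,
      Submodule.Quotient.mk_eq_zero] at hz
    exact (Submodule.Quotient.mk_eq_zero _).mpr (h y hz)
  · exact fun z => by
      obtain ⟨z, rfl⟩ := Submodule.mkQ_surjective _ z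
      obtain ⟨z, rfl⟩ := Submodule.mkQ_surjective _ z
      exact ⟨Submodule.Quotient.mk z, rfl⟩
  · intro z
    obtain ⟨z, rfl⟩ := Submodule.mkQ_surjective _ z
    rw [Submodule.mkQ_apply, Submodule.mapQ_apply, Submodule.Quotient.mk_eq_zero, hmap]
    constructor
    · rintro ⟨w, hw, e⟩
      have : z - w ∈ x • (⊤ : Submodule A N) := by
        rw [← Submodule.ker_mkQ (x • (⊤ : Submodule A N)), LinearMap.mem_ker, map_sub, e, sub_self]
      obtain ⟨y, -, hy⟩ := (Submodule.mem_smul_pointwise_iff_exists _ _ _).mp this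
      refine ⟨Submodule.Quotient.mk y, ?_⟩
      rw [Submodule.mapQ_apply, Submodule.Quotient.eq]
      change x • y - z ∈ (I ^ (n + 1) • ⊤ : Submodule A N)
      rw [hy, sub_sub_cancel_left]
      exact neg_mem hw
    · rintro ⟨w, e⟩
      obtain ⟨y, rfl⟩ := Submodule.mkQ_surjective _ w
      rw [Submodule.mkQ_apply, Submodule.mapQ_apply, Submodule.Quotient.eq] at e
      refine ⟨z - x • y, ?_, ?_⟩
      · have := neg_mem e
        rwa [neg_sub] at this
      · rw [map_sub, sub_eq_self, ← LinearMap.mem_ker, Submodule.ker_mkQ]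
        exact Submodule.smul_mem_pointwise_smul _ _ _ trivial

end HilbertFunction

section Multiplicity

open Polynomial in
theorem eq_C_of_eventually_eval_eq {P : ℚ[X]} {c : ℚ}
    (h : ∀ᶠ n : ℕ in Filter.atTop, c = P.eval (n : ℚ)) : P = C c := by
  refine eq_of_infinite_eval_eq _ _ ?_
  obtain ⟨m, hm⟩ := Filter.eventually_atTop.mp h
  refine Set.infinite_of_injective_forall_mem (f := fun n : ℕ => ((n + m : ℕ) : ℚ))
    (fun a b hab => by simpa using hab) fun n => ?_
  rw [Set.mem_ofPred_eq, eval_C, ← hm _ (by omega)]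

theorem isSMulRegular_of_forall_notMem_associatedPrimes {A : Type u} [CommRing A] [IsNoetherianRing A]
    {N : Type u} [AddCommGroup N] [Module A N]
    {x : A} (h : ∀ P ∈ associatedPrimes A N, x ∉ P) : IsSMulRegular N x := by
  refine (isSMulRegular_iff_right_eq_zero_of_smul).mpr fun y hy => ?_
  by_contra hne
  have : x ∈ ⋃ p ∈ associatedPrimes A N, (p : Set A) := by
    rw [biUnion_associatedPrimes_eq_zero_divisors]
    exact ⟨y, hne, hy⟩
  obtain ⟨P, hP, hxP⟩ := Set.mem_iUnion₂.mp this
  exact h P hP hxP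

variable {A : Type u} [CommRing A] [IsLocalRing A] [IsNoetherianRing A]

theorem exists_submodule_maximalIdeal_isSMulRegular (N : Type u) [AddCommGroup N] [Module A N]
    [Module.Finite A N] {y : A} (hy : y ∈ maximalIdeal A) (hreg : IsSMulRegular N y) :
    ∃ s : Finset (Submodule A (maximalIdeal A)), (∀ p ∈ s, p ≠ ⊤) ∧
      ∀ x : maximalIdeal A, (∀ p ∈ s, x ∉ p) → IsSMulRegular N (x : A) := by
  classical
  have hfin := associatedPrimes.finite A N
  let φ : Ideal A → Submodule A (maximalIdeal A) := fun P =>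
    Submodule.comap (maximalIdeal A).subtype P
  refine ⟨hfin.toFinset.image φ, fun p hp htop => ?_, fun x hx => ?_⟩
  · obtain ⟨P, hP, rfl⟩ := Finset.mem_image.mp hp
    have hyP : y ∈ P := by
      have : (⟨y, hy⟩ : maximalIdeal A) ∈ φ P := htop ▸ Submodule.mem_top
      exact this
    have : y ∈ ⋃ p ∈ associatedPrimes A N, (p : Set A) :=
      Set.mem_iUnion₂_of_mem (hfin.mem_toFinset.mp hP) hyP
    rw [biUnion_associatedPrimes_eq_zero_divisors] at this
    obtain ⟨z, hz, h0⟩ := this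
    exact hz (hreg.right_eq_zero_of_smul h0)
  · exact isSMulRegular_of_forall_notMem_associatedPrimes fun P hP hxP =>
      hx (φ P) (Finset.mem_image_of_mem _ (hfin.mem_toFinset.mpr hP)) hxP

theorem length_quotient_maximalIdeal_pow_ne_top (N : Type u) [AddCommGroup N] [Module A N]
    [Module.Finite A N] (n : ℕ) :
    Module.length A (N ⧸ (maximalIdeal A ^ n • ⊤ : Submodule A N)) ≠ ⊤ := by
  rw [Module.length_ne_top_iff]
  refine isFiniteLength_of_pow_le_annihilator (n := n) fun a ha => ?_
  refine Module.mem_annihilator.mpr fun z => ?_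
  obtain ⟨z, rfl⟩ := Submodule.mkQ_surjective _ z
  exact (Submodule.Quotient.mk_eq_zero _).mpr (Submodule.smul_mem_smul ha trivial)

open Polynomial in
/-- The length of `N ⧸ xs N` for a sufficiently general regular sequence `xs` of maximal length is
the normalized leading coefficient of the Hilbert polynomial of `N`. -/
theorem exists_isRegular_length_eq [Infinite (ResidueField A)] (d : ℕ) :
    ∀ (N L : Type u) [AddCommGroup N] [Module A N] [Module.Finite A N]
      [AddCommGroup L] [Module A L] [Module.Finite A L],
      (∃ ys : List A, ys.length = d ∧ (∀ y ∈ ys, y ∈ maximalIdeal A) ∧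
        RingTheory.Sequence.IsRegular N ys) →
      (∃ ys : List A, ys.length = d ∧ (∀ y ∈ ys, y ∈ maximalIdeal A) ∧
        RingTheory.Sequence.IsRegular L ys) →
      Module.supportDim A N ≤ d →
      ∀ P : ℚ[X], (∀ᶠ n : ℕ in Filter.atTop,
        ((Module.length A (N ⧸ (maximalIdeal A ^ (n + 1) • ⊤ : Submodule A N))).toNat : ℚ) =
          P.eval (n : ℚ)) →
      ∃ xs : List A, xs.length = d ∧ (∀ x ∈ xs, x ∈ maximalIdeal A) ∧
        RingTheory.Sequence.IsRegular N xs ∧ RingTheory.Sequence.IsRegular L xs ∧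
        P.natDegree ≤ d ∧
        ((Module.length A (N ⧸ (Ideal.ofList xs • ⊤ : Submodule A N))).toNat : ℚ) =
          (d.factorial : ℚ) * P.coeff d := by
  classical
  induction d with
  | zero =>
    rintro N L _ _ _ _ _ _ ⟨ys, hys, -, hN⟩ ⟨zs, hzs, -, hL⟩ hdim P hP
    obtain rfl := List.eq_nil_of_length_eq_zero hys
    obtain rfl := List.eq_nil_of_length_eq_zero hzs
    obtain ⟨m, hm⟩ := exists_pow_le_annihilator_of_supportDim_le_zero hdim
    have hbot (I : Ideal A) (hI : I ≤ Module.annihilator A N) :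
        Module.length A (N ⧸ (I • ⊤ : Submodule A N)) = Module.length A N := by
      have : (I • ⊤ : Submodule A N) = ⊥ := eq_bot_iff.mpr <| Submodule.smul_le.mpr
        fun a ha y _ => (Submodule.mem_bot A).mpr (Module.mem_annihilator.mp (hI ha) y)
      rw [this]
      exact (Submodule.quotEquivOfEqBot ⊥ rfl).length_eq
    -- In dimension zero a power of `𝔪` kills `N`, so the Hilbert function is eventually constant.
    have hC : P = C ((Module.length A N).toNat : ℚ) := by
      refine eq_C_of_eventually_eval_eq ?_
      filter_upwards [hP, Filter.eventually_ge_atTop m] with n hn hmn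
      rw [← hn, hbot _ ((Ideal.pow_le_pow_right (by omega)).trans hm)]
    refine ⟨[], rfl, by simp, hN, hL, ?_, ?_⟩
    · rw [hC, natDegree_C]
    · rw [hbot _ (by simp), hC]
      simp
  | succ d ih =>
    rintro N L _ _ _ _ _ _ ⟨ys, hys, hysm, hN⟩ ⟨zs, hzs, hzsm, hL⟩ hdim P hP
    obtain ⟨y, hy, hyN⟩ : ∃ y ∈ maximalIdeal A, IsSMulRegular N y := by
      obtain _ | ⟨y, ys⟩ := ys
      · simp at hys
      · exact ⟨y, hysm y (by simp), ((RingTheory.Sequence.isRegular_cons_iff _ _ _).mp hN).1⟩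
    obtain ⟨z, hz, hzL⟩ : ∃ z ∈ maximalIdeal A, IsSMulRegular L z := by
      obtain _ | ⟨z, zs⟩ := zs
      · simp at hzs
      · exact ⟨z, hzsm z (by simp), ((RingTheory.Sequence.isRegular_cons_iff _ _ _).mp hL).1⟩
    obtain ⟨s₁, hs₁, h₁⟩ := exists_submodule_maximalIdeal_isSMulRegular N hy hyN
    obtain ⟨s₂, hs₂, h₂⟩ := exists_submodule_maximalIdeal_isSMulRegular L hz hzL
    obtain ⟨s₃, hs₃, h₃⟩ := exists_superficial (maximalIdeal A) N
    -- One general `x` is regular on `N` and on `L` and superficial for `N`.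
    obtain ⟨⟨x, hxm⟩, hx⟩ := exists_forall_notMem_of_ne_top (A := A) (s₁ ∪ (s₂ ∪ s₃)) id (by
      intro p hp
      rcases Finset.mem_union.mp hp with hp | hp
      · exact hs₁ p hp
      · exact (Finset.mem_union.mp hp).elim (hs₂ p) (hs₃ p))
    have hxN : IsSMulRegular N x := h₁ ⟨x, hxm⟩ fun p hp => hx p (by simp [hp])
    have hxL : IsSMulRegular L x := h₂ ⟨x, hxm⟩ fun p hp => hx p (by simp [hp])
    obtain ⟨m, hm⟩ := h₃ ⟨x, hxm⟩ (fun p hp => hx p (by simp [hp])) hxN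
    obtain ⟨xs, hlen, hxs, hxsN, hxsL, hdeg, hlength⟩ := ih (QuotSMulTop x N) (QuotSMulTop x L)
      (exists_isRegular_quotSMulTop hN hysm hys hxm hxN)
      (exists_isRegular_quotSMulTop hL hzsm hzs hxm hxL)
      (by
        have hNt := hN.nontrivial
        rw [← Module.supportDim_quotSMulTop_succ_eq_supportDim hxN hxm] at hdim
        rw [Nat.cast_add, Nat.cast_one] at hdim
        exact ENat.WithBot.add_le_add_one_right_iff.mp hdim)
      -- Superficiality makes the Hilbert function of `N/xN` eventually the difference of that of
      -- `N`.
      (P - P.comp (X - C 1)) (by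
        have hP' : ∀ᶠ n : ℕ in Filter.atTop, ((Module.length A
            (N ⧸ (maximalIdeal A ^ n • ⊤ : Submodule A N))).toNat : ℚ) = P.eval ((n : ℚ) - 1) := by
          rw [Filter.eventually_atTop] at hP ⊢
          obtain ⟨b, hb⟩ := hP
          refine ⟨b + 1, fun n hn => ?_⟩
          obtain ⟨n, rfl⟩ := Nat.exists_eq_add_of_le' (show 1 ≤ n by omega)
          rw [hb n (by omega)]
          simp
        filter_upwards [hP, hP', Filter.eventually_ge_atTop m] with n h h' hmn
        have hsum := length_quotient_pow_succ_eq_add (maximalIdeal A) N x hxm n (hm n hmn)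
        have := congrArg ENat.toNat hsum
        rw [ENat.toNat_add (length_quotient_maximalIdeal_pow_ne_top _ _)
          (length_quotient_maximalIdeal_pow_ne_top _ _)] at this
        rw [eval_sub, eval_comp, ← h, this]
        simp [← h'])
    have hdegP := natDegree_le_succ_of_sub_comp P hdeg
    refine ⟨x :: xs, by simp [hlen], ?_, ?_, ?_, hdegP, ?_⟩
    · simpa using ⟨hxm, hxs⟩
    · exact (RingTheory.Sequence.isRegular_cons_iff _ _ _).mpr ⟨hxN, hxsN⟩
    · exact (RingTheory.Sequence.isRegular_cons_iff _ _ _).mpr ⟨hxL, hxsL⟩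
    · rw [(Submodule.quotOfListConsSMulTopEquivQuotSMulTopInner N x xs).length_eq, hlength,
        coeff_sub_comp_X_sub_one P hdegP, Nat.factorial_succ]
      push_cast
      ring

end Multiplicity

/-! ### Consequences of minimal multiplicity -/

section MinimalMultiplicity

theorem le_of_length_quotient_le {A : Type u} [CommRing A] {I J : Ideal A} (hIJ : I ≤ J)
    (hfin : Module.length A (A ⧸ J) ≠ ⊤)
    (h : Module.length A (A ⧸ I) ≤ Module.length A (A ⧸ J)) : J ≤ I := by
  have hadd := Module.length_eq_add_of_exact (LinearMap.ker (Submodule.factor hIJ)).subtype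
    (Submodule.factor hIJ) (Submodule.injective_subtype _) (Submodule.factor_surjective hIJ)
    (LinearMap.exact_subtype_ker_map _)
  have h0 : Module.length A (LinearMap.ker (Submodule.factor hIJ)) = 0 := by
    rw [hadd] at h
    by_contra hne
    exact absurd h (not_le.mpr (ENat.lt_add_left hfin (pos_iff_ne_zero.mpr hne)))
  rw [Module.length_eq_zero_iff, Submodule.subsingleton_iff_eq_bot] at h0
  intro a ha
  have : (Submodule.Quotient.mk a : A ⧸ I) ∈ LinearMap.ker (Submodule.factor hIJ) :=
    (Submodule.Quotient.mk_eq_zero _).mpr ha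
  rw [h0, Submodule.mem_bot, Submodule.Quotient.mk_eq_zero] at this
  exact this

variable {A : Type u} [CommRing A] [IsLocalRing A]

theorem length_quotient_maximalIdeal_sq [IsNoetherianRing A] :
    Module.length A (A ⧸ maximalIdeal A ^ 2) =
      ((1 + (maximalIdeal A).spanFinrank : ℕ) : ℕ∞) := by
  have h1 : Module.length A (maximalIdeal A).Cotangent =
      Module.finrank (ResidueField A) (CotangentSpace A) := by
    rw [← Module.length_eq_finrank]
    exact Module.length_eq_of_surjective (M := CotangentSpace A) (residue_surjective (R := A))
  have hle : maximalIdeal A ^ 2 ≤ maximalIdeal A := Ideal.pow_le_self two_ne_zero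
  have h2 := Module.length_eq_add_of_exact (maximalIdeal A).cotangentToQuotientSquare
    (Submodule.factor hle) (Ideal.cotangentToQuotientSquare_injective _)
    (Submodule.factor_surjective hle) (by
      rw [LinearMap.exact_iff, Ideal.range_cotangentToQuotientSquare]
      ext z
      obtain ⟨z, rfl⟩ := Ideal.Quotient.mk_surjective z
      rw [Submodule.restrictScalars_mem, Ideal.mk_mem_cotangentIdeal, LinearMap.mem_ker]
      exact Submodule.Quotient.mk_eq_zero _)
  have : IsSimpleModule A (A ⧸ maximalIdeal A) :=
    isSimpleModule_iff_isCoatom.mpr (maximalIdeal.isMaximal A).out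
  rw [h2, h1, Module.length_eq_one, spanFinrank_maximalIdeal_eq_finrank_cotangentSpace]
  push_cast
  ring

/-- Since `𝔪x ⊆ 𝔪² ⊆ I`, the kernel of `A/I → A/(I + (x))` is an image of `k`. -/
theorem length_quotient_le_length_quotient_sup_span_singleton {I : Ideal A}
    (hI : maximalIdeal A ^ 2 ≤ I) {x : A} (hx : x ∈ maximalIdeal A) :
    Module.length A (A ⧸ I) ≤ Module.length A (A ⧸ I ⊔ Ideal.span {x}) + 1 := by
  let f : (A ⧸ maximalIdeal A) →ₗ[A] A ⧸ I :=
    (maximalIdeal A).liftQ (LinearMap.toSpanSingleton A (A ⧸ I) (Submodule.Quotient.mk x))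
      fun a ha => by
        rw [LinearMap.mem_ker, LinearMap.toSpanSingleton_apply, ← Submodule.Quotient.mk_smul,
          Submodule.Quotient.mk_eq_zero]
        exact hI (sq (maximalIdeal A) ▸ Ideal.mul_mem_mul ha hx)
  have : IsSimpleModule A (A ⧸ maximalIdeal A) :=
    isSimpleModule_iff_isCoatom.mpr (maximalIdeal.isMaximal A).out
  have h1 : Module.length A (LinearMap.range f) ≤ 1 := by
    rw [← Module.length_eq_one A (A ⧸ maximalIdeal A)]
    exact Module.length_le_of_surjective f.rangeRestrict f.surjective_rangeRestrict
  have hle : I ≤ I ⊔ Ideal.span {x} := le_sup_left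
  rw [Module.length_eq_add_of_exact (LinearMap.range f).subtype (Submodule.factor hle)
    (Submodule.injective_subtype _) (Submodule.factor_surjective hle) (by
      rw [LinearMap.exact_iff, Submodule.range_subtype, Submodule.range_liftQ,
        LinearMap.range_toSpanSingleton]
      ext z
      obtain ⟨z, rfl⟩ := Submodule.mkQ_surjective _ z
      rw [LinearMap.mem_ker, Submodule.mkQ_apply, Submodule.mem_span_singleton]
      refine (Submodule.Quotient.mk_eq_zero _).trans ?_
      rw [Submodule.mem_sup]
      constructor
      · rintro ⟨y, hy, w, hw, rfl⟩
        obtain ⟨a, rfl⟩ := Ideal.mem_span_singleton'.mp hw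
        refine ⟨a, ?_⟩
        rw [← Submodule.Quotient.mk_smul, Submodule.Quotient.eq, smul_eq_mul]
        simpa using hy
      · rintro ⟨a, ha⟩
        rw [← Submodule.Quotient.mk_smul, Submodule.Quotient.eq, smul_eq_mul] at ha
        exact ⟨z - a * x, by simpa using neg_mem ha, a * x, Ideal.mem_span_singleton'.mpr ⟨a, rfl⟩,
          sub_add_cancel z (a * x)⟩), add_comm]
  gcongr

/-- In minimal multiplicity, a regular sequence computing the multiplicity is part of a minimal
generating set of the maximal ideal and generates a reduction of reduction number one. -/
theorem sq_le_and_notMem_of_length_quotient [IsNoetherianRing A] {xs : List A}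
    (hm : ∀ x ∈ xs, x ∈ maximalIdeal A)
    (hlen : Module.length A (A ⧸ Ideal.ofList xs) + xs.length =
      ((1 + (maximalIdeal A).spanFinrank : ℕ) : ℕ∞)) :
    maximalIdeal A ^ 2 ≤ Ideal.ofList xs ∧
      ∀ (j : ℕ) (hj : j < xs.length), xs[j] ∉ Ideal.ofList (xs.take j) ⊔ maximalIdeal A ^ 2 := by
  -- `q 0 = 𝔪²` has colength `1 + μ(𝔪)`, and each step lowers the colength by at most one. But
  -- `hlen` bounds the last colength by `1 + μ(𝔪)` minus the number of steps. So every step drops by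
  -- exactly one, giving the non-membership, and `(xs)` has the colength of `q xs.length`, giving
  -- `𝔪² ⊆ (xs)`.
  let q : ℕ → Ideal A := fun j => Ideal.ofList (xs.take j) ⊔ maximalIdeal A ^ 2
  have hq (j : ℕ) (hj : j < xs.length) : q (j + 1) = q j ⊔ Ideal.span {xs[j]} := by
    simp only [q]
    rw [ofList_take_succ xs hj, sup_right_comm]
  have hfin (j : ℕ) : ∃ n : ℕ, Module.length A (A ⧸ q j) = n := by
    refine ENat.ne_top_iff_exists.mp (ne_top_of_le_ne_top ?_ (Module.length_le_of_surjective
      (Submodule.factor (le_sup_right : maximalIdeal A ^ 2 ≤ q j))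
      (Submodule.factor_surjective _))) |>.imp fun _ h => h.symm
    rw [length_quotient_maximalIdeal_sq]
    exact ENat.natCast_ne_top _
  choose n hn using hfin
  have hstep (j : ℕ) (hj : j < xs.length) : n j ≤ n (j + 1) + 1 := by
    have := length_quotient_le_length_quotient_sup_span_singleton (I := q j) le_sup_right
      (hm _ (List.getElem_mem hj))
    rw [← hq j hj, hn, hn] at this
    exact_mod_cast this
  have h0 : n 0 = 1 + (maximalIdeal A).spanFinrank := by
    have := hn 0
    rw [show q 0 = maximalIdeal A ^ 2 by simp [q], length_quotient_maximalIdeal_sq] at this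
    exact_mod_cast this.symm
  have hle : Ideal.ofList xs ≤ q xs.length := by
    simp only [q, List.take_length]
    exact le_sup_left
  have hlast : n xs.length + xs.length ≤ 1 + (maximalIdeal A).spanFinrank := by
    have := Module.length_le_of_surjective (Submodule.factor hle) (Submodule.factor_surjective hle)
    rw [hn] at this
    have := (add_le_add_left this (xs.length : ℕ∞)).trans hlen.le
    exact_mod_cast this
  have hlow (j : ℕ) (hj : j ≤ xs.length) : n 0 ≤ n j + j := by
    induction j with
    | zero => simp
    | succ j ih =>
      have := ih (by omega)
      have := hstep j (by omega)
      omega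
  have hup (k j : ℕ) (hj : j + k = xs.length) : n j ≤ n xs.length + k := by
    induction k generalizing j with
    | zero => rw [← hj]; simp
    | succ k ih =>
      have := ih (j + 1) (by omega)
      have := hstep j (by omega)
      omega
  refine ⟨le_sup_right.trans (le_of_length_quotient_le hle (by rw [hn]; exact ENat.natCast_ne_top _)
    ?_), fun j hj hmem => ?_⟩
  · have := hlow xs.length le_rfl
    rw [hn]
    have h2 : Module.length A (A ⧸ Ideal.ofList xs) + xs.length ≤
        (n xs.length : ℕ∞) + xs.length := by
      rw [hlen]
      exact_mod_cast (by omega : 1 + (maximalIdeal A).spanFinrank ≤ n xs.length + xs.length)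
    exact (ENat.add_le_add_iff_right (ENat.natCast_ne_top _)).mp h2
  · have heq : n j = n (j + 1) := by
      have h1 : q (j + 1) = q j := by
        rw [hq j hj]
        exact sup_eq_left.mpr ((Ideal.span_singleton_le_iff_mem _).mpr hmem)
      have := hn (j + 1)
      rw [h1, hn] at this
      exact_mod_cast this
    have := hlow j hj.le
    have := hup (xs.length - (j + 1)) (j + 1) (by omega)
    omega

/-- Over a Cohen-Macaulay ring of minimal multiplicity with infinite residue field, there is a
regular sequence `xs` of maximal length that is part of a minimal generating set of the maximal
ideal `𝔪` and satisfies `𝔪 ^ 2 = xs 𝔪`. -/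
theorem HasMinimalMultiplicity.exists_isRegular [IsNoetherianRing A] [Infinite (ResidueField A)]
    (hmult : HasMinimalMultiplicity A) {d : ℕ} (hd : ringKrullDim A = d)
    (hA : ∃ ys : List A, ys.length = d ∧ (∀ y ∈ ys, y ∈ maximalIdeal A) ∧
      RingTheory.Sequence.IsRegular A ys)
    (L : Type u) [AddCommGroup L] [Module A L] [Module.Finite A L]
    (hL : ∃ ys : List A, ys.length = d ∧ (∀ y ∈ ys, y ∈ maximalIdeal A) ∧
      RingTheory.Sequence.IsRegular L ys) :
    ∃ xs : List A, xs.length = d ∧ (∀ x ∈ xs, x ∈ maximalIdeal A) ∧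
      RingTheory.Sequence.IsRegular A xs ∧ RingTheory.Sequence.IsRegular L xs ∧
      maximalIdeal A ^ 2 ≤ Ideal.ofList xs * maximalIdeal A ∧
      ∀ (j : ℕ) (hj : j < xs.length), xs[j] ∉ Ideal.ofList (xs.take j) ⊔ maximalIdeal A ^ 2 := by
  obtain ⟨e, d', ⟨P, hP, he⟩, hd', hed⟩ := hmult
  obtain rfl : d' = d := by
    rw [hd] at hd'
    exact_mod_cast hd'.symm
  have hP' : ∀ᶠ n : ℕ in Filter.atTop, ((Module.length A
      (A ⧸ (maximalIdeal A ^ (n + 1) • ⊤ : Submodule A A))).toNat : ℚ) = P.eval (n : ℚ) := by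
    filter_upwards [hP] with n hn
    rw [← hn, smul_eq_mul, Ideal.mul_top]
  obtain ⟨xs, hlen, hm, hxA, hxL, hdeg, hl⟩ := exists_isRegular_length_eq d' A L hA hL
    (by rw [Module.supportDim_self_eq_ringKrullDim, hd]) P hP'
  rw [smul_eq_mul, Ideal.mul_top] at hl
  have hfin : Module.length A (A ⧸ Ideal.ofList xs) ≠ ⊤ := by
    have := isFiniteLength_quotient_of_isRegular hxA (by rw [hd, hlen])
    rw [smul_eq_mul, Ideal.mul_top] at this
    exact Module.length_ne_top_iff.mpr this
  have hnt : Nontrivial (A ⧸ Ideal.ofList xs) := Ideal.Quotient.nontrivial_iff.mpr fun h =>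
    (maximalIdeal.isMaximal A).ne_top (top_le_iff.mp (h ▸ Ideal.span_le.mpr hm))
  have hpos : (Module.length A (A ⧸ Ideal.ofList xs)).toNat ≠ 0 :=
    fun h => (ENat.toNat_eq_zero.mp h).elim Module.length_pos.ne' hfin
  -- `IsMultiplicity` normalizes by `P.natDegree`, so the degree has to be identified with the
  -- dimension; a smaller degree would make the length zero.
  have hdeg' : P.natDegree = d' := by
    refine le_antisymm hdeg (le_of_not_gt fun hlt => hpos ?_)
    rw [Polynomial.coeff_eq_zero_of_natDegree_lt hlt, mul_zero] at hl
    exact_mod_cast hl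
  have hel : (Module.length A (A ⧸ Ideal.ofList xs)).toNat = e := by
    rw [← hdeg'] at hl
    exact_mod_cast hl.trans he.symm
  obtain ⟨hsq, hnot⟩ := sq_le_and_notMem_of_length_quotient hm (by
    rw [← ENat.natCast_toNat hfin, hel, hlen]
    have : e + d' = 1 + (maximalIdeal A).spanFinrank := by omega
    exact_mod_cast this)
  refine ⟨xs, hlen, hm, hxA, hxL, ?_, hnot⟩
  -- Independence modulo `𝔪²` sharpens `𝔪² ⊆ (xs)` to `𝔪² ⊆ (xs)𝔪`.
  have := ofList_take_inf_sq_le hm hnot xs.length le_rfl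
  rw [List.take_length] at this
  exact (le_inf hsq le_rfl).trans this

end MinimalMultiplicity

/-! ### Enlarging the residue field -/

section InfiniteResidueField

open Polynomial in
/-- Every Noetherian local ring has a faithfully flat local extension of the same dimension, with
an infinite residue field, whose maximal ideal is the extension of the original one. -/
theorem exists_faithfullyFlat_infinite_residueField (R : Type u) [CommRing R] [IsLocalRing R]
    [IsNoetherianRing R] :
    ∃ (S : Type u) (_ : CommRing S) (_ : IsLocalRing S) (_ : Algebra R S),
      IsNoetherianRing S ∧ Module.FaithfullyFlat R S ∧ IsLocalHom (algebraMap R S) ∧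
      (maximalIdeal R).map (algebraMap R S) = maximalIdeal S ∧ Infinite (ResidueField S) ∧
      ringKrullDim S = ringKrullDim R := by
  -- The extension is `R[X]` localized at `𝔪R[X]`; in its residue field the powers of `X` stay
  -- distinct.
  let q : Ideal R[X] := (maximalIdeal R).map C
  have hq : q.IsPrime := Ideal.isPrime_map_C_of_isPrime
  let S := Localization.AtPrime q
  have hmap : (maximalIdeal R).map (algebraMap R S) = maximalIdeal S := by
    rw [IsScalarTower.algebraMap_eq R R[X] S, ← Ideal.map_map]
    exact Localization.AtPrime.map_eq_maximalIdeal
  have hloc : IsLocalHom (algebraMap R S) :=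
    ((local_hom_TFAE (algebraMap R S)).out 0 2 rfl rfl).mpr hmap.le
  have hflat : Module.Flat R S := Module.Flat.trans R R[X] S
  refine ⟨S, inferInstance, inferInstance, inferInstance,
    IsLocalization.isNoetherianRing q.primeCompl _ inferInstance,
    Module.FaithfullyFlat.of_flat_of_isLocalHom, hloc, hmap, ?_, ?_⟩
  · refine Infinite.of_injective (fun n : ℕ => residue S (algebraMap R[X] S (X ^ n))) ?_
    intro a b hab
    simp only at hab
    rw [← sub_eq_zero, ← map_sub, ← map_sub, residue_eq_zero_iff,
      ← Ideal.mem_comap, ← Ideal.under_def, IsLocalization.AtPrime.under_maximalIdeal S q,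
      Ideal.mem_map_C_iff] at hab
    by_contra hne
    have := hab a
    rw [coeff_sub, coeff_X_pow_self, coeff_X_pow, if_neg hne, sub_zero] at this
    exact (Ideal.ne_top_iff_one _).mp (maximalIdeal.isMaximal R).ne_top this
  · rw [← maximalIdeal_height_eq_ringKrullDim, ← maximalIdeal_height_eq_ringKrullDim,
      ← IsLocalization.height_under q.primeCompl, IsLocalization.AtPrime.under_maximalIdeal _ q,
      height_map_C]

variable {R : Type u} [CommRing R] [IsLocalRing R] {S : Type u} [CommRing S] [IsLocalRing S]
  [Algebra R S] [Module.Flat R S] [IsLocalHom (algebraMap R S)]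

/-- Flat local base change multiplies lengths by the length of `S/𝔪S`, here equal to `1`. The
Hilbert function is thus unchanged, and with it, through `R/𝔪²`, the embedding dimension. -/
theorem length_quotient_maximalIdeal_pow_eq
    (hmap : (maximalIdeal R).map (algebraMap R S) = maximalIdeal S) (n : ℕ) :
    Module.length S (S ⧸ maximalIdeal S ^ n) = Module.length R (R ⧸ maximalIdeal R ^ n) := by
  have : IsSimpleModule S (S ⧸ maximalIdeal S) :=
    isSimpleModule_iff_isCoatom.mpr (maximalIdeal.isMaximal S).out
  rw [← hmap, ← Ideal.map_pow,
    (Algebra.TensorProduct.quotIdealMapEquivTensorQuot S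
      (maximalIdeal R ^ n)).toLinearEquiv.length_eq,
    IsLocalRing.length_baseChange, hmap,
    Module.length_eq_one S (S ⧸ maximalIdeal S), mul_one]

theorem HasMinimalMultiplicity.of_flat [IsNoetherianRing R] [IsNoetherianRing S]
    (h : HasMinimalMultiplicity R)
    (hmap : (maximalIdeal R).map (algebraMap R S) = maximalIdeal S)
    (hdim : ringKrullDim S = ringKrullDim R) : HasMinimalMultiplicity S := by
  obtain ⟨e, d, ⟨P, hP, he⟩, hd, hed⟩ := h
  refine ⟨e, d, ⟨P, ?_, he⟩, hdim.trans hd, ?_⟩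
  · filter_upwards [hP] with n hn
    rw [length_quotient_maximalIdeal_pow_eq hmap, hn]
  · have h := length_quotient_maximalIdeal_pow_eq hmap 2
    rw [length_quotient_maximalIdeal_sq, length_quotient_maximalIdeal_sq] at h
    have h' : 1 + (maximalIdeal S).spanFinrank = 1 + (maximalIdeal R).spanFinrank := by
      exact_mod_cast h
    rw [hed]
    omega

end InfiniteResidueField

/-! ### From `Ext` of `L` to `Ext` of the residue field -/

section Descent

variable {A : Type u} [CommRing A]

theorem isWeaklyRegular_of_free {xs : List A} (h : RingTheory.Sequence.IsWeaklyRegular A xs)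
    (F : Type u) [AddCommGroup F] [Module A F] [Module.Free A F] :
    RingTheory.Sequence.IsWeaklyRegular F xs := by
  refine ⟨fun i hi => (isSMulRegular_quotient_iff_mem_of_smul_mem _ _).mpr fun v hv => ?_⟩
  let b := Module.Free.chooseBasis A F
  rw [mem_ideal_smul_top_iff_repr b] at hv ⊢
  intro t
  have h1 := (isSMulRegular_quotient_iff_mem_of_smul_mem _ _).mp (h.regular_mod_prev i hi)
    (b.repr v t)
  rw [smul_eq_mul, Ideal.mul_top] at h1
  refine h1 ?_
  simpa using hv t

variable [IsLocalRing A] [IsNoetherianRing A]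

/-- If `d + 1` consecutive modules `Extⁱ(L, A)` vanish for a module `L` with a regular sequence
`xs` such that `𝔪 L = xs L`, and `𝔪 ^ 2 ⊆ (xs)`, then `Extⁱ(k, A)` vanishes for `i > d`. -/
theorem ExtVanishes.residueField_of_maximalIdeal_smul_le {xs : List A}
    (hxs : RingTheory.Sequence.IsRegular A xs) (hm : ∀ x ∈ xs, x ∈ maximalIdeal A)
    (hsq : maximalIdeal A ^ 2 ≤ Ideal.ofList xs)
    {L : Type u} [AddCommGroup L] [Module A L]
    (hL : RingTheory.Sequence.IsRegular L xs)
    (hle : maximalIdeal A • (⊤ : Submodule A L) ≤ Ideal.ofList xs • ⊤)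
    {s : ℕ} (hs : 1 ≤ s) (h : ∀ i, s ≤ i → i ≤ s + xs.length → ExtVanishes A L i) (i : ℕ)
    (hi : xs.length < i) : ExtVanishes A (ResidueField A) i := by
  have hbot {M : Type u} [AddCommGroup M] [Module A M] {N : Submodule A M}
      (hN : maximalIdeal A • (⊤ : Submodule A M) ≤ N) :
      maximalIdeal A • (⊤ : Submodule A (M ⧸ N)) = ⊥ := by
    rw [← Submodule.range_mkQ, ← Submodule.map_top, ← Submodule.map_smul'', eq_bot_iff,
      Submodule.map_le_iff_le_comap]
    exact hN.trans (Submodule.ker_mkQ N).ge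
  -- By `hle`, `L/(xs)L` is a nonzero vector space, so `k` is a summand of it.
  have hk : ExtVanishes A (ResidueField A) (s + xs.length) := by
    have hnt : Nontrivial (L ⧸ (Ideal.ofList xs • ⊤ : Submodule A L)) :=
      Submodule.Quotient.nontrivial_iff.mpr hL.top_ne_smul.symm
    obtain ⟨f, g, hfg⟩ := exists_residueField_retract (hbot hle)
    exact (ExtVanishes.quotient_ofList hL.toIsWeaklyRegular s h).of_retract f g hfg
  have hI : Ideal.ofList xs ≤ maximalIdeal A := Ideal.span_le.mpr hm
  have hB (j : ℕ) (hj : xs.length < j) : ExtVanishes A (A ⧸ Ideal.ofList xs) j := by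
    obtain ⟨t, rfl⟩ := Nat.exists_eq_add_of_lt hj
    have := ExtVanishes.quotient_ofList hxs.toIsWeaklyRegular (t + 1) fun i hi _ => by
      obtain ⟨i, rfl⟩ := Nat.exists_eq_add_of_le' (show 1 ≤ i by omega)
      exact extVanishes_of_projective i
    rw [smul_eq_mul, Ideal.mul_top, add_comm, ← add_assoc] at this
    exact this
  let g : (A ⧸ Ideal.ofList xs) →ₗ[A] ResidueField A := Submodule.factor hI
  have hg : Function.Surjective g := Submodule.factor_surjective hI
  let K := LinearMap.ker g
  have hinj := K.injective_subtype
  have hex : Function.Exact K.subtype g := LinearMap.exact_subtype_ker_map g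
  -- If `K = 𝔪/(xs)` is zero, then `k = A/(xs)` and `hB` suffices.
  rcases subsingleton_or_nontrivial K with hK | hK
  · exact (hB i hi).of_linearEquiv (LinearEquiv.ofBijective g
      ⟨LinearMap.ker_eq_bot.mp ((Submodule.subsingleton_iff_eq_bot).mp hK), hg⟩).symm
  have hKm : maximalIdeal A • (⊤ : Submodule A K) = ⊥ := by
    refine eq_bot_iff.mpr (Submodule.smul_le.mpr fun a ha z _ => (Submodule.mem_bot A).mpr ?_)
    obtain ⟨z, hz⟩ := z
    obtain ⟨z, rfl⟩ := Submodule.mkQ_surjective _ z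
    refine Subtype.ext ((Submodule.Quotient.mk_eq_zero _).mpr (hsq ?_))
    have hz' : z ∈ maximalIdeal A := (Submodule.Quotient.mk_eq_zero _).mp hz
    exact sq (maximalIdeal A) ▸ Ideal.mul_mem_mul ha hz'
  obtain ⟨φ, ψ, hφ⟩ := exists_residueField_retract hKm
  have hKfin : IsFiniteLength A K := isFiniteLength_of_pow_le_annihilator (n := 1) fun a ha => by
    rw [pow_one] at ha
    refine Module.mem_annihilator.mpr fun z => ?_
    have : a • z ∈ maximalIdeal A • (⊤ : Submodule A K) := Submodule.smul_mem_smul ha trivial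
    rwa [hKm] at this
  -- Upwards, vanishing for `k` gives vanishing for the finite-length module `K`; downwards, it
  -- holds for `K` and hence for its summand `k`.
  have hstep (j : ℕ) (hj : xs.length < j) :
      ExtVanishes A (ResidueField A) j ↔ ExtVanishes A (ResidueField A) (j + 1) :=
    ⟨fun h => .right hinj hex hg (h.of_isFiniteLength hKfin) (hB (j + 1) (by omega)),
      fun h => (ExtVanishes.left hinj hex hg (hB j hj) h).of_retract φ ψ hφ⟩
  have hall (j : ℕ) :
      ExtVanishes A (ResidueField A) (xs.length + 1) ↔
        ExtVanishes A (ResidueField A) (xs.length + 1 + j) := by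
    induction j with
    | zero => rfl
    | succ j ih => exact ih.trans (hstep _ (by omega))
  obtain ⟨a, rfl⟩ := Nat.exists_eq_add_of_le (show xs.length + 1 ≤ i by omega)
  obtain ⟨b, hb⟩ := Nat.exists_eq_add_of_le (show xs.length + 1 ≤ s + xs.length by omega)
  rw [hb] at hk
  exact (hall a).mp ((hall b).mpr hk)

end Descent

/-! ### Base change of the resolution and of the surjection onto `L` -/

section BaseChange

theorem exact_subtype_rangeRestrict {R K F M : Type*} [CommRing R] [AddCommGroup K] [Module R K]
    [AddCommGroup F] [Module R F] [AddCommGroup M] [Module R M] {f : K →ₗ[R] F} {g : F →ₗ[R] M}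
    (h : Function.Exact f g) :
    Function.Exact (LinearMap.range f).subtype g.rangeRestrict := by
  rw [LinearMap.exact_iff, Submodule.range_subtype, LinearMap.ker_rangeRestrict]
  exact LinearMap.exact_iff.mp h

variable {R S : Type u} [CommRing R] [CommRing S] [Algebra R S]

theorem tmul_mem_map_smul_top {M : Type u} [AddCommGroup M] [Module R M] (I : Ideal R) (s : S)
    {w : M} (hw : w ∈ I • (⊤ : Submodule R M)) :
    s ⊗ₜ[R] w ∈ I.map (algebraMap R S) • (⊤ : Submodule S (S ⊗[R] M)) := by
  refine Submodule.smul_induction_on hw (fun a ha m _ => ?_) fun x y hx hy => ?_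
  · rw [TensorProduct.tmul_smul, ← algebraMap_smul S a]
    exact Submodule.smul_mem_smul (Ideal.mem_map_of_mem _ ha) trivial
  · rw [TensorProduct.tmul_add]
    exact add_mem hx hy

theorem ideal_smul_top_le_of_directSum {ι : Type} [DecidableEq ι] {N : ι → Type u}
    [∀ i, AddCommGroup (N i)] [∀ i, Module R (N i)] {L : Type u} [AddCommGroup L] [Module R L]
    (f : DirectSum ι N →ₗ[R] L) (hf : Function.Surjective f) (I J : Ideal S)
    (h : ∀ i, I • (⊤ : Submodule S (S ⊗[R] N i)) ≤ J • ⊤) :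
    I • (⊤ : Submodule S (S ⊗[R] L)) ≤ J • ⊤ := by
  refine Submodule.smul_le.mpr fun a ha z _ => ?_
  induction z with
  | zero => rw [smul_zero]; exact zero_mem _
  | add x y hx hy => rw [smul_add]; exact add_mem (hx trivial) (hy trivial)
  | tmul s l =>
    obtain ⟨v, rfl⟩ := hf l
    induction v using DirectSum.induction_on with
    | zero => rw [map_zero, TensorProduct.tmul_zero, smul_zero]; exact zero_mem _
    | add x y hx hy =>
      rw [map_add, TensorProduct.tmul_add, smul_add]
      exact add_mem (hx trivial) (hy trivial)
    | of i w =>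
      let g := (f ∘ₗ DirectSum.lof R ι N i).baseChange S
      have h1 : a • (s ⊗ₜ[R] w) ∈ J • (⊤ : Submodule S (S ⊗[R] N i)) :=
        h i (Submodule.smul_mem_smul ha trivial)
      have h2 := Submodule.mem_map_of_mem (f := g) h1
      rw [Submodule.map_smul''] at h2
      have h3 : g (a • (s ⊗ₜ[R] w)) = a • (s ⊗ₜ[R] f (DirectSum.of N i w)) := by
        rw [map_smul]
        rfl
      rw [← h3]
      exact Submodule.smul_mono le_rfl le_top h2

end BaseChange

section BaseChangeOfResolution

variable {R : Type u} [CommRing R] [IsLocalRing R]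

theorem MinimalFreeResolution.exists_syzygy_exact {M : Type u} [AddCommGroup M] [Module R M]
    (F : MinimalFreeResolution R M) (n : ℕ) :
    ∃ (ι : F.syzygy (n + 1) →ₗ[R] (Fin (F.rank n) → R))
      (p : (Fin (F.rank n) → R) →ₗ[R] F.syzygy n),
      Function.Injective ι ∧ Function.Exact ι p ∧ Function.Surjective p ∧
        LinearMap.range ι ≤ maximalIdeal R • ⊤ := by
  refine ⟨(LinearMap.range (F.diff n)).subtype, ?_⟩
  have hr : LinearMap.range (LinearMap.range (F.diff n)).subtype = LinearMap.range (F.diff n) :=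
    Submodule.range_subtype _
  cases n with
  | zero =>
    refine ⟨F.aug.rangeRestrict, Submodule.injective_subtype _,
      exact_subtype_rangeRestrict F.exact_aug, F.aug.surjective_rangeRestrict,
      hr.le.trans (F.minimal 0)⟩
  | succ n =>
    refine ⟨(F.diff n).rangeRestrict, Submodule.injective_subtype _,
      exact_subtype_rangeRestrict (F.exact_diff n), (F.diff n).surjective_rangeRestrict,
      hr.le.trans (F.minimal (n + 1))⟩

variable {S : Type u} [CommRing S] [Algebra R S]

variable [IsLocalRing S]

/-- Flatness and `𝔪S = 𝔪_S` keep the base-changed resolution exact and minimal, so the induction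
runs over `S`, starting from `S ⊗ k`, which `𝔪_S` kills. -/
theorem isRegularOnMaximalIdealSMul_syzygy [Module.Flat R S]
    (hmap : (maximalIdeal R).map (algebraMap R S) = maximalIdeal S)
    (F : MinimalFreeResolution R (ResidueField R)) {xs : List S}
    (hm : ∀ x ∈ xs, x ∈ maximalIdeal S) (hxs : RingTheory.Sequence.IsWeaklyRegular S xs)
    (hsq : maximalIdeal S ^ 2 ≤ Ideal.ofList xs * maximalIdeal S)
    (hnot : ∀ (j : ℕ) (hj : j < xs.length),
      xs[j] ∉ Ideal.ofList (xs.take j) ⊔ maximalIdeal S ^ 2) (n : ℕ) :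
    IsRegularOnMaximalIdealSMul xs (S ⊗[R] F.syzygy n) ∧
      maximalIdeal S • (⊤ : Submodule S (S ⊗[R] F.syzygy n)) ≤ Ideal.ofList xs • ⊤ := by
  induction n with
  | zero =>
    have h0 : maximalIdeal S • (⊤ : Submodule S (S ⊗[R] F.syzygy 0)) = ⊥ := by
      rw [← hmap]
      refine eq_bot_iff.mpr ?_
      rw [Ideal.map, Submodule.span_smul_eq, Submodule.set_smul_le_iff]
      rintro _ z ⟨a, ha, rfl⟩ -
      rw [Submodule.mem_bot]
      induction z with
      | zero => rw [smul_zero]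
      | add x y hx hy => rw [smul_add, hx, hy, add_zero]
      | tmul s w =>
        rw [algebraMap_smul, ← TensorProduct.tmul_smul]
        have hw : a • w = 0 := by
          obtain ⟨w, hw⟩ := w
          refine Subtype.ext (show a • w = 0 from ?_)
          obtain ⟨r, rfl⟩ := residue_surjective w
          rw [← algebraMap_smul (ResidueField R) a, ResidueField.algebraMap_eq,
            (residue_eq_zero_iff a).mpr ha, zero_smul]
        rw [hw, TensorProduct.tmul_zero]
    exact ⟨isRegularOnMaximalIdealSMul_of_smul_eq_bot xs _ h0, h0 ▸ bot_le⟩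
  | succ n ih =>
    obtain ⟨ι, p, hι, hιp, hp, hmin⟩ := F.exists_syzygy_exact n
    have hι' : Function.Injective (ι.baseChange S) :=
      Module.Flat.lTensor_preserves_injective_linearMap ι hι
    have hιp' : Function.Exact (ι.baseChange S) (p.baseChange S) := lTensor_exact S hιp hp
    have hp' : Function.Surjective (p.baseChange S) := LinearMap.lTensor_surjective S hp
    have hmin' : LinearMap.range (ι.baseChange S) ≤
        maximalIdeal S • (⊤ : Submodule S (S ⊗[R] (Fin (F.rank n) → R))) := by
      rintro _ ⟨z, rfl⟩
      induction z with
      | zero => rw [map_zero]; exact zero_mem _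
      | add x y hx hy => rw [map_add]; exact add_mem hx hy
      | tmul s w =>
        rw [LinearMap.baseChange_tmul, ← hmap]
        exact tmul_mem_map_smul_top _ s (hmin ⟨w, rfl⟩)
    refine ⟨ih.1.syzygy hι' hιp' hp' hmin' hm (isWeaklyRegular_of_free hxs _) (fun j hj => ?_),
      ih.1.maximalIdeal_smul_le hι' hιp' hp' hmin' hm hsq⟩
    rw [← mul_smul]
    exact smul_top_inf_smul_top_le (ofList_take_inf_sq_le hm hnot j hj.le)

/-- The residue field is compatible with base change to `S` if the maximal ideal of `R` generates
the maximal ideal of `S`. -/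
theorem nonempty_baseChange_residueField
    (hmap : (maximalIdeal R).map (algebraMap R S) = maximalIdeal S) :
    Nonempty (S ⊗[R] ResidueField R ≃ₗ[S] ResidueField S) :=
  ⟨(Algebra.TensorProduct.quotIdealMapEquivTensorQuot S (maximalIdeal R)).toLinearEquiv.symm ≪≫ₗ
    Submodule.quotEquivOfEq _ _ hmap⟩

end BaseChangeOfResolution

/-! ### From consecutive vanishing to Gorenstein -/

section Main

variable {R : Type u} [CommRing R] [IsLocalRing R] [IsNoetherianRing R]

/-- The Gorenstein property is not itself descended from `S`. Vanishing of `Ext` of `L` ascends to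
`S`, vanishing of `Ext` of the residue field descends to `R`, and the conclusion is drawn over `R`.
-/
theorem isGorenstein_of_extVanishes_of_directSum_syzygy {d : ℕ} (hd : ringKrullDim R = d)
    (hR : ∃ ys : List R, ys.length = d ∧ (∀ y ∈ ys, y ∈ maximalIdeal R) ∧
      RingTheory.Sequence.IsRegular R ys)
    (hmult : HasMinimalMultiplicity R) (F : MinimalFreeResolution R (ResidueField R))
    {L : Type u} [AddCommGroup L] [Module R L] [Module.Finite R L]
    (hL : ∃ ys : List R, ys.length = d ∧ (∀ y ∈ ys, y ∈ maximalIdeal R) ∧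
      RingTheory.Sequence.IsRegular L ys)
    {r : ℕ} (ν : Fin r → ℕ) (f : DirectSum (Fin r) (fun j => (F.syzygy (ν j) : Type u)) →ₗ[R] L)
    (hf : Function.Surjective f) {s : ℕ} (hs : 1 ≤ s)
    (h : ∀ i, s ≤ i → i ≤ s + d → ExtVanishes R L i) : IsGorenstein R := by
  obtain ⟨S, _, _, _, hnoeth, hff, hloc, hmap, hinf, hdim⟩ :=
    exists_faithfullyFlat_infinite_residueField R
  have hreg (M : Type u) [AddCommGroup M] [Module R M]
      (hM : ∃ ys : List R, ys.length = d ∧ (∀ y ∈ ys, y ∈ maximalIdeal R) ∧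
        RingTheory.Sequence.IsRegular M ys) (M' : Type u) [AddCommGroup M'] [Module R M']
      [Module S M'] [IsScalarTower R S M'] (φ : M →ₗ[R] M') (hφ : IsBaseChange S φ) :
      ∃ ys : List S, ys.length = d ∧ (∀ y ∈ ys, y ∈ maximalIdeal S) ∧
        RingTheory.Sequence.IsRegular M' ys := by
    obtain ⟨ys, hlen, hm, hys⟩ := hM
    refine ⟨ys.map (algebraMap R S), by simpa using hlen, fun y hy => ?_,
      hys.of_faithfullyFlat_of_isBaseChange hφ⟩
    obtain ⟨z, hz, rfl⟩ := List.mem_map.mp hy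
    exact hmap ▸ Ideal.mem_map_of_mem _ (hm z hz)
  obtain ⟨xs, rfl, hm, hxS, hxL, hsq, hnot⟩ := (hmult.of_flat hmap hdim).exists_isRegular
    (hdim.trans hd) (hreg R hR S _ (IsBaseChange.linearMap R S)) (S ⊗[R] L)
    (hreg L hL _ _ (TensorProduct.isBaseChange R L S))
  have hle := ideal_smul_top_le_of_directSum f hf (maximalIdeal S) (Ideal.ofList xs) fun j =>
    (isRegularOnMaximalIdealSMul_syzygy hmap F hm hxS.toIsWeaklyRegular hsq hnot (ν j)).2
  refine isGorenstein_of_extVanishes (d := xs.length) fun i hi => ?_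
  obtain ⟨i, rfl⟩ := Nat.exists_eq_add_of_le' (show 1 ≤ i by omega)
  obtain ⟨e⟩ := nonempty_baseChange_residueField hmap
  rw [← extVanishes_baseChange_iff (S := S)]
  refine .of_linearEquiv (ExtVanishes.residueField_of_maximalIdeal_smul_le hxS hm
    (hsq.trans Ideal.mul_le_left) hxL hle hs (fun j h1 h2 => ?_) _ hi) e
  obtain ⟨j, rfl⟩ := Nat.exists_eq_add_of_le' (show 1 ≤ j by omega)
  exact (extVanishes_baseChange_iff L j).mpr (h _ h1 h2)

end Main

end LocalAlgebra

theorem theorem5p1 (R : Type u) [CommRing R] [IsLocalRing R] [IsNoetherianRing R]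
    (d : ℕ) (hd : ringKrullDim R = d)
    (hCM : LocalAlgebra.IsCohenMacaulay R)
    (hmult : LocalAlgebra.HasMinimalMultiplicity R)
    (F : LocalAlgebra.MinimalFreeResolution R (IsLocalRing.ResidueField R))
    (L : Type u) [AddCommGroup L] [Module R L] [Nontrivial L]
    (hL : LocalAlgebra.IsMaximalCohenMacaulay R L)
    (r : ℕ) (ν : Fin r → ℕ)
    (f : DirectSum (Fin r) (fun j => (F.syzygy (ν j) : Type u)) →ₗ[R] L)
    (hf : Function.Surjective f) :
    List.TFAE
      [∃ s : ℕ, 1 ≤ s ∧ ∀ i : ℕ, s ≤ i → i ≤ s + d →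
          Subsingleton (CategoryTheory.Abelian.Ext (ModuleCat.of R L) (ModuleCat.of R R) i),
        ∀ i : ℕ, 1 ≤ i →
          Subsingleton (CategoryTheory.Abelian.Ext (ModuleCat.of R L) (ModuleCat.of R R) i),
        LocalAlgebra.IsGorenstein R] := by
  have hLfin := hL.finite
  have hR := LocalAlgebra.exists_isRegular_of_depth_eq (M := R) (d := d) (by
    have := hCM.trans hd
    exact_mod_cast this)
  have hLreg := LocalAlgebra.exists_isRegular_of_depth_eq (M := L) (d := d) (by
    have := hL.depth_eq.trans hd
    exact_mod_cast this)
  tfae_have 2 → 1 := fun h => ⟨1, le_rfl, fun i hi _ => h i hi⟩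
  tfae_have 3 → 2 := fun h => by
    obtain ⟨xs, hlen, -, hxs⟩ := hR
    obtain ⟨ys, hlen', hm, hys⟩ := hLreg
    exact h.extVanishes hxs (by rw [hd, hlen]) hys hm (hlen'.trans hlen.symm)
  tfae_have 1 → 3 := fun ⟨s, hs, h⟩ =>
    LocalAlgebra.isGorenstein_of_extVanishes_of_directSum_syzygy hd hR hmult F hLreg ν f hf hs h
  tfae_finish
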